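/- Let $n\ge 2$, $-1\le a\le 1$, $b>0$, and let $E_n=(0,\dots,0,1)^t\in\mathbb R^n$. Let $\mathfrak{so}(n)$ be the space of real skew-symmetric $n\times n$ matrices, $\mathrm S^{n-1}\subset\mathbb R^n$ the unit sphere, $u\wedge v=uv^t-vu^t$ for $u,v\in\mathbb R^n$, and $\mathbb J=\mathrm{Id}_n+aE_nE_n^t$. For $\gamma\in \mathrm S^{n-1}$ let $L_\gamma:\mathfrak{so}(n)\to\mathfrak{so}(n)$ be $$L_\gamma(\Omega)=\mathbb J\Omega+\Omega\mathbb J+b\,(\Omega\gamma)\wedge\gamma ,$$ and put $x=\langle\gamma,E_n\rangle$ and $\Delta(x)=(2+a)(2+b)-abx^2$. The reduced equations of motion of the axisymmetric $n$-dimensional Chaplygin sphere are $$\dot M=[M,\Omega]=M\Omega-\Omega M,\qquad \dot\gamma=-\Omega\gamma,\qquad M=L_\gamma(\Omega),$$ for $M,\Omega\in\mathfrak{so}(n)$ and $\gamma\in \mathrm S^{n-1}$. Let $dM$ and $d\Omega$ denote the same translation-invariant (Lebesgue) measure on $\mathfrak{so}(n)$, in any normalization, and $d\gamma$ the surface measure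 of $\mathrm S^{n-1}$. Then: 1. For every $\gamma\in \mathrm S^{n-1}$ we have $\Delta(x)>0$ and $\det L_\gamma=c\,\Delta(x)^{n-2}$ with the constant $c=(2+a+b)\,2^{(n-2)(n-3)/2}$. In particular $L_\gamma$ is invertible. 2. For every initial condition $(M_0,\gamma_0)\in\mathfrak{so}(n)\times \mathrm S^{n-1}$ the equations of motion have exactly one solution $(M(t),\gamma(t))$, $t\in\mathbb R$, and the resulting flow on $\mathfrak{so}(n)\times \mathrm S^{n-1}\ni(M,\gamma)$ preserves the measure $\Delta(x)^{-\frac{n-2}{2}}\,dM\,d\gamma$. 3. Equivalently, the flow of the same system written in the variables $(\Omega,\gamma)\in\mathfrak{so}(n)\times \mathrm S^{n-1}$ (which likewise exists, uniquely and for all times) preserves the measure $\Delta(x)^{\frac{n-2}{2}}\,d\Omega\,d\gamma$. The two measures agree up to the constant $c$: the map $(\Omega,\gamma)\mapsto(L_\gamma(\Omega),\gamma)$ is a bijection of $\mathfrak{so}(n)\times \mathrm S^{n-1}$ that carries the measure $c\,\Delta(x)^{\frac{n-2}{2}}\,d\Omega\,d\gamma$ to $\Delta(x)^{-\frac{n-2}{2}}\,dM\,d\gamma$.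 -/

import Mathlib

open MeasureTheory Matrix Metric LieAlgebra.Orthogonal

namespace Chaplygin

noncomputable section

/-- `so(n)` carries the Borel sigma-algebra of its topology as a subspace of the matrices. -/
instance (n : ℕ) : MeasurableSpace (so (Fin n) ℝ) := borel _

instance (n : ℕ) : BorelSpace (so (Fin n) ℝ) := ⟨rfl⟩

/-- The wedge product `u ∧ v = u vᵗ - v uᵗ` of column vectors, an element of `so(n)`. -/
def wedge {n : ℕ} (u v : Fin n → ℝ) : so (Fin n) ℝ :=
  ⟨vecMulVec u v - vecMulVec v u, by
    rw [mem_so, transpose_sub, transpose_vecMulVec, transpose_vecMulVec, neg_sub]⟩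

/-- The last vector `E_n` of the standard basis of `ℝⁿ`. -/
def axis (n : ℕ) : Fin n → ℝ := fun i => if (i : ℕ) + 1 = n then 1 else 0

/-- The inertia tensor `Ω ↦ 𝕁 Ω + Ω 𝕁` on `so(n)` of a symmetric mass tensor `𝕁`. -/
def inertia {n : ℕ} (J : Matrix (Fin n) (Fin n) ℝ) (hJ : J.IsSymm) :
    so (Fin n) ℝ →ₗ[ℝ] so (Fin n) ℝ where
  toFun Ω := ⟨J * Ω.1 + Ω.1 * J, by
    have h := (mem_so (Fin n) ℝ Ω.1).1 Ω.2
    rw [mem_so, transpose_add, transpose_mul, transpose_mul, h, hJ.eq]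
    simp only [neg_mul, mul_neg]
    abel⟩
  map_add' A B := by
    apply Subtype.ext
    change J * (A.1 + B.1) + (A.1 + B.1) * J = (J * A.1 + A.1 * J) + (J * B.1 + B.1 * J)
    rw [mul_add, add_mul]
    abel
  map_smul' c A := by
    apply Subtype.ext
    change J * (c • A.1) + (c • A.1) * J = c • (J * A.1 + A.1 * J)
    rw [mul_smul_comm, smul_mul_assoc, smul_add]

/-- The linear map `Ω ↦ (Ω γ) ∧ γ` on `so(n)`. -/
def contact {n : ℕ} (γ : Fin n → ℝ) : so (Fin n) ℝ →ₗ[ℝ] so (Fin n) ℝ where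
  toFun Ω := wedge (Ω.1 *ᵥ γ) γ
  map_add' A B := by
    apply Subtype.ext
    change vecMulVec ((A.1 + B.1) *ᵥ γ) γ - vecMulVec γ ((A.1 + B.1) *ᵥ γ) =
      (vecMulVec (A.1 *ᵥ γ) γ - vecMulVec γ (A.1 *ᵥ γ)) +
        (vecMulVec (B.1 *ᵥ γ) γ - vecMulVec γ (B.1 *ᵥ γ))
    rw [add_mulVec, add_vecMulVec, vecMulVec_add]
    abel
  map_smul' c A := by
    apply Subtype.ext
    change vecMulVec ((c • A.1) *ᵥ γ) γ - vecMulVec γ ((c • A.1) *ᵥ γ) =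
      c • (vecMulVec (A.1 *ᵥ γ) γ - vecMulVec γ (A.1 *ᵥ γ))
    rw [smul_mulVec, smul_vecMulVec, vecMulVec_smul, smul_sub]

/-- The axisymmetric mass tensor `𝕁 = Id + a E_n E_nᵗ`. -/
def massTensor (n : ℕ) (a : ℝ) : Matrix (Fin n) (Fin n) ℝ :=
  1 + a • vecMulVec (axis n) (axis n)

theorem massTensor_isSymm (n : ℕ) (a : ℝ) : (massTensor n a).IsSymm := by
  unfold massTensor Matrix.IsSymm
  rw [transpose_add, transpose_one, transpose_smul, transpose_vecMulVec]

/-- The unit sphere of Euclidean `ℝⁿ`. -/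
abbrev UnitSphere (n : ℕ) : Type := sphere (0 : EuclideanSpace ℝ (Fin n)) 1

/-- The space `so(n) × Sⁿ⁻¹` of pairs `(M, γ)`, or of pairs `(Ω, γ)`. -/
abbrev Phase (n : ℕ) : Type := so (Fin n) ℝ × UnitSphere n

/-- The operator `L_γ(Ω) = 𝕀(Ω) + b (Ω γ) ∧ γ` that gives the angular momentum about the contact
point from the angular velocity, for the axisymmetric mass tensor. -/
def L {n : ℕ} (a b : ℝ) (γ : UnitSphere n) : so (Fin n) ℝ →ₗ[ℝ] so (Fin n) ℝ :=
  inertia (massTensor n a) (massTensor_isSymm n a) + b • contact γ.1.ofLp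

/-- The change of variables `(Ω, γ) ↦ (M, γ) = (L_γ(Ω), γ)`. -/
def legendre {n : ℕ} (a b : ℝ) (p : Phase n) : Phase n := (L a b p.2 p.1, p.2)

/-- The curves `M`, `Ω` in `so(n)` and `γ` in the unit sphere satisfy, for all times, the equations
of motion `M = L_γ(Ω)`, `dM/dt = [M, Ω]`, `dγ/dt = -Ω γ`. The derivatives are taken entrywise. -/
structure IsMotion {n : ℕ} (a b : ℝ) (M Ω : ℝ → so (Fin n) ℝ) (γ : ℝ → UnitSphere n) :
    Prop where
  momentum : ∀ t, M t = L a b (γ t) (Ω t)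
  deriv_momentum : ∀ t i j, HasDerivAt (fun s => (M s).1 i j)
    (((M t).1 * (Ω t).1 - (Ω t).1 * (M t).1) i j) t
  deriv_poisson : ∀ t i, HasDerivAt (fun s => (γ s).1 i) ((-((Ω t).1 *ᵥ (γ t).1.ofLp)) i) t

/-- A curve `t ↦ (M(t), γ(t))` that solves the equations of motion. -/
def IsMomentumSolution {n : ℕ} (a b : ℝ) (c : ℝ → Phase n) : Prop :=
  ∃ Ω : ℝ → so (Fin n) ℝ, IsMotion a b (fun t => (c t).1) Ω (fun t => (c t).2)

/-- A curve `t ↦ (Ω(t), γ(t))` that solves the equations of motion. -/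
def IsVelocitySolution {n : ℕ} (a b : ℝ) (c : ℝ → Phase n) : Prop :=
  ∃ M : ℝ → so (Fin n) ℝ, IsMotion a b M (fun t => (c t).1) (fun t => (c t).2)

/-- `Φ` is the flow of the system with the given solution curves: through each point `p` at time
`0` there is exactly one solution defined for all times, and it is `t ↦ Φ t p`. -/
def IsFlow {X : Type*} (IsSolution : (ℝ → X) → Prop) (Φ : ℝ → X → X) : Prop :=
  ∀ (p : X) (c : ℝ → X), (IsSolution c ∧ c 0 = p) ↔ ∀ t, c t = Φ t p

/-- `x = ⟨γ, E_n⟩`, the last coordinate of `γ`. -/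
def height {n : ℕ} (γ : UnitSphere n) : ℝ := γ.1.ofLp ⬝ᵥ axis n

/-- `Δ(x) = (2 + a)(2 + b) - a b x²`. -/
def Delta (a b x : ℝ) : ℝ := (2 + a) * (2 + b) - a * b * x ^ 2

/-- The measure `Δ(x)^s dM dγ` on `so(n) × Sⁿ⁻¹`, where `dM` is the measure `ν` and `dγ` is the
surface measure of the unit sphere. -/
def deltaMeasure {n : ℕ} (a b s : ℝ) (ν : Measure (so (Fin n) ℝ)) : Measure (Phase n) :=
  (ν.prod (volume : Measure (EuclideanSpace ℝ (Fin n))).toSphere).withDensity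
    fun p => ENNReal.ofReal (Delta a b (height p.2) ^ s)

end

end Chaplygin

/-! The exponent comes from a fact valid for every symmetric positive inertia operator: the system
preserves `(det L_γ)^(-1/2) dM dγ`. Axial symmetry serves to evaluate the determinant.

Let γ range over all of ℝⁿ, replace b by a radial function κ(γ), and write L = 𝕀 + κΠ with Π(Ω) =
(Ωγ) ∧ γ. Put τ = κ tr(L⁻¹ ad_Ω Π), which is `twist`. Since Π is equivariant and κ invariant under
rotations, the derivative of L along -Ωγ is κ(Π ad_Ω - ad_Ω Π). As L and Π are symmetric and ad_Ω is
skew, log det L changes at the rate -2τ (`trace_inv_mul_fderiv_op`). The divergence of the field is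
-τ: the M-part has trace zero, and the γ-part has trace -τ (`trace_field_fst`, `trace_field_snd`).
Hence ρ = (det L)^(-1/2) satisfies Xρ + ρ div X = 0 (`divergence_field`).

The function |M|² + |γ|² is conserved and has compact sublevel sets. This makes the flow complete
and reduces Liouville's theorem to fields of compact support (`measurePreserving_flow`). For these
the flow over a short time h is compared with the Euler step x + hY(x), whose weighted Jacobian is ρ
+ o(h); so the flow is only needed to be Lipschitz in its initial point.

To reach the sphere, κ is taken to be b/|γ|² for |γ| ≥ 1. There L depends only on the direction of
γ, the flow commutes with scaling of γ, and the measure on an annulus projects radially to a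
multiple of the measure on the sphere (`measurePreserving_sphereFlow`).

For the determinant, L_γ(Ω) = AΩ + ΩA with A = 𝕁 + bγγᵗ. Wedges of eigenvectors of A diagonalise
L_γ, with sums of two eigenvalues of A as eigenvalues. Those of A are 1 + q₁, 1 + q₂ and n - 2 times
1, and (2 + q₁)(2 + q₂) = Δ (`det_L`). The statement in (Ω, γ) follows by conjugation with L, whose
Jacobian det L turns the exponent -1/2 into 1/2. -/

namespace Chaplygin

/-! ### Global flows of bounded Lipschitz vector fields -/

section Flow

open Set Filter Topology NNReal

variable {E : Type*} [NormedAddCommGroup E] [NormedSpace ℝ E]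

/-- `φ` is a global flow of the vector field `Y`. -/
structure IsGlobalFlow (Y : E → E) (φ : ℝ → E → E) : Prop where
  zero : ∀ x, φ 0 x = x
  hasDerivAt : ∀ x t, HasDerivAt (fun s => φ s x) (Y (φ t x)) t

/-- A solution of a field bounded by C stays within C * T of its start up to time T, so
Picard–Lindelöf applies on every interval [-T, T]. Uniqueness glues these solutions. -/
theorem exists_isGlobalFlow [CompleteSpace E] {Y : E → E} {K C : ℝ≥0} (hY : LipschitzWith K Y)
    (hC : ∀ x, ‖Y x‖ ≤ C) : ∃ φ, IsGlobalFlow Y φ := by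
  have key : ∀ (x : E) (T : ℝ≥0), ∃ α : ℝ → E, α 0 = x ∧
      ∀ t ∈ Icc (-T : ℝ) T, HasDerivWithinAt α (Y (α t)) (Icc (-T : ℝ) T) t := by
    intro x T
    have h : IsPicardLindelof (fun _ : ℝ => Y) (tmin := -T) (tmax := T)
        ⟨0, by simp⟩ x (C * T) 0 C K :=
      { lipschitzOnWith := fun _ _ => hY.lipschitzOnWith
        continuousOn := fun _ _ => continuousOn_const
        norm_le := fun _ _ y _ => hC y
        mul_max_le := by simp }
    exact h.exists_eq_forall_mem_Icc_hasDerivWithinAt₀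
  choose α hα0 hα using key
  have hd : ∀ x (T : ℝ≥0) t, t ∈ Ioo (-T : ℝ) T →
      HasDerivAt (α x T) (Y (α x T t)) t := fun x T t ht =>
    (hα x T t (Ioo_subset_Icc_self ht)).hasDerivAt (Icc_mem_nhds ht.1 ht.2)
  have huniq : ∀ x (S T : ℝ≥0), S ≤ T → ∀ t ∈ Ioo (-S : ℝ) S, α x S t = α x T t := by
    intro x S T hST t ht
    have hS : (0 : ℝ) < S := by
      have := ht.1.trans ht.2
      linarith
    have hST' : (S : ℝ) ≤ T := hST
    refine ODE_solution_unique_of_mem_Ioo (v := fun _ => Y) (s := fun _ => univ) (K := K)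
      (t₀ := 0) (a := -S) (b := S) (fun _ _ => hY.lipschitzOnWith) ⟨by linarith, hS⟩
      (fun s hs => ⟨hd x S s hs, trivial⟩)
      (fun s hs => ⟨hd x T s ⟨by linarith [hs.1], by linarith [hs.2]⟩, trivial⟩)
      (by rw [hα0, hα0]) ht
  refine ⟨fun t x => α x (‖t‖₊ + 1) t, fun x => hα0 _ _, fun x t => ?_⟩
  have h1 : t ∈ Ioo (-((‖t‖₊ + 1 : ℝ≥0) : ℝ)) ((‖t‖₊ + 1 : ℝ≥0) : ℝ) := by
    have := abs_lt.1 (lt_add_one |t|)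
    simpa using this
  refine (hd x (‖t‖₊ + 1) t h1).congr_of_eventuallyEq ?_
  filter_upwards [Ioo_mem_nhds h1.1 h1.2] with s hs
  have h2 : s ∈ Ioo (-((‖s‖₊ + 1 : ℝ≥0) : ℝ)) ((‖s‖₊ + 1 : ℝ≥0) : ℝ) := by
    have := abs_lt.1 (lt_add_one |s|)
    simpa using this
  rcases le_total (‖s‖₊ + 1) (‖t‖₊ + 1) with h | h
  · exact huniq x _ _ h s h2
  · exact (huniq x _ _ h s hs).symm

namespace IsGlobalFlow

variable {Y : E → E} {φ : ℝ → E → E} {K : ℝ≥0}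

theorem eq_of_hasDerivAt (hφ : IsGlobalFlow Y φ) (hY : LipschitzWith K Y) {c : ℝ → E}
    (hc : ∀ t, HasDerivAt c (Y (c t)) t) (t : ℝ) : c t = φ t (c 0) := by
  refine congrFun (ODE_solution_unique_univ (v := fun _ => Y) (s := fun _ => univ) (K := K)
    (t₀ := 0) (fun _ => hY.lipschitzOnWith) (fun t => ⟨hc t, trivial⟩)
    (fun t => ⟨hφ.hasDerivAt (c 0) t, trivial⟩) (hφ.zero _).symm) t

theorem map_add (hφ : IsGlobalFlow Y φ) (hY : LipschitzWith K Y) (s t : ℝ) (x : E) :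
    φ (s + t) x = φ s (φ t x) := by
  have h := hφ.eq_of_hasDerivAt hY (c := fun r => φ (r + t) x)
    (fun r => (hφ.hasDerivAt x (r + t)).comp_add_const r t) s
  simpa using h

theorem eq_self_of_eq_zero (hφ : IsGlobalFlow Y φ) (hY : LipschitzWith K Y) {x : E}
    (hx : Y x = 0) (t : ℝ) : φ t x = x :=
  (hφ.eq_of_hasDerivAt hY (c := fun _ => x)
    (fun t => by simpa [hx] using hasDerivAt_const t x) t).symm

theorem neg (hφ : IsGlobalFlow Y φ) : IsGlobalFlow (fun x => -Y x) (fun t => φ (-t)) where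
  zero x := by simpa using hφ.zero x
  hasDerivAt x t := by
    simpa [Function.comp_def] using (hφ.hasDerivAt x (-t)).scomp t (hasDerivAt_neg t)

theorem lipschitzWith_of_nonneg (hφ : IsGlobalFlow Y φ) (hY : LipschitzWith K Y) {t : ℝ}
    (ht : 0 ≤ t) : LipschitzWith (Real.exp (K * t)).toNNReal (φ t) := by
  refine LipschitzWith.of_dist_le_mul fun x y => ?_
  have h := dist_le_of_trajectories_ODE (v := fun _ => Y) (K := K) (a := 0) (b := t)
    (fun _ => hY)
    (fun s _ => (hφ.hasDerivAt x s).continuousAt.continuousWithinAt)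
    (fun s _ => (hφ.hasDerivAt x s).hasDerivWithinAt)
    (fun s _ => (hφ.hasDerivAt y s).continuousAt.continuousWithinAt)
    (fun s _ => (hφ.hasDerivAt y s).hasDerivWithinAt) (le_refl _) t ⟨ht, le_rfl⟩
  rw [hφ.zero, hφ.zero, sub_zero] at h
  rw [Real.coe_toNNReal _ (Real.exp_pos _).le, mul_comm]
  exact h

theorem exists_lipschitzWith (hφ : IsGlobalFlow Y φ) (hY : LipschitzWith K Y) (t : ℝ) :
    ∃ L, LipschitzWith L (φ t) := by
  rcases le_total 0 t with ht | ht
  · exact ⟨_, hφ.lipschitzWith_of_nonneg hY ht⟩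
  · have hY' : LipschitzWith K (fun x => -Y x) := hY.neg
    have h := hφ.neg.lipschitzWith_of_nonneg hY' (neg_nonneg.2 ht)
    rw [neg_neg] at h
    exact ⟨_, h⟩

theorem norm_sub_self_le (hφ : IsGlobalFlow Y φ) {C : ℝ≥0} (hC : ∀ x, ‖Y x‖ ≤ C) (x : E) (t : ℝ) :
    ‖φ t x - x‖ ≤ C * |t| := by
  have h := Convex.norm_image_sub_le_of_norm_hasDerivWithin_le (f := fun s => φ s x) (s := univ)
    (x := 0) (y := t) (C := C) (fun s _ => (hφ.hasDerivAt x s).hasDerivWithinAt)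
    (fun s _ => hC _) convex_univ trivial trivial
  simpa [hφ.zero] using h

/-- The derivative of φ_s(x) - sY(x) is Y(φ_s(x)) - Y(x), which is at most K * C * |s| in norm; the
mean value inequality makes the error quadratic in t. -/
theorem norm_sub_euler_le (hφ : IsGlobalFlow Y φ) (hY : LipschitzWith K Y) {C : ℝ≥0}
    (hC : ∀ x, ‖Y x‖ ≤ C) (x : E) (t : ℝ) :
    ‖φ t x - (x + t • Y x)‖ ≤ K * C * |t| * |t| := by
  have h := Convex.norm_image_sub_le_of_norm_hasDerivWithin_le
    (f := fun s => φ s x - s • Y x) (s := Icc (-|t|) |t|)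
    (f' := fun s => Y (φ s x) - Y x)
    (x := 0) (y := t) (C := K * C * |t|)
    (fun s _ => by
      have h := (hφ.hasDerivAt x s).fun_sub ((hasDerivAt_id s).smul_const (Y x))
      simpa using h.hasDerivWithinAt)
    (fun s hs => by
      refine (hY.norm_sub_le _ _).trans ?_
      rw [mul_assoc]
      refine mul_le_mul_of_nonneg_left ((hφ.norm_sub_self_le hC x s).trans ?_) K.2
      exact mul_le_mul_of_nonneg_left (abs_le.2 hs) C.2)
    (convex_Icc _ _) (by simp) ⟨neg_abs_le t, le_abs_self t⟩
  rw [zero_smul, sub_zero, hφ.zero, sub_zero, Real.norm_eq_abs] at h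
  rwa [add_comm, ← sub_sub]

end IsGlobalFlow

end Flow

end Chaplygin
namespace Chaplygin

/-! ### Derivatives of determinants, and measures determined by Lipschitz functions -/

section Liouville

open Set Filter Topology NNReal

variable {E : Type*} [NormedAddCommGroup E] [NormedSpace ℝ E]

/-- The determinant is a smooth function of the endomorphism. -/
theorem contDiff_det [FiniteDimensional ℝ E] {m : WithTop ℕ∞} :
    ContDiff ℝ m (fun A : E →L[ℝ] E => A.det) := by
  let v := Module.finBasis ℝ E
  have h : (fun A : E →L[ℝ] E => A.det) =
      fun A : E →L[ℝ] E => (LinearMap.toMatrix v v (A : E →ₗ[ℝ] E)).det := by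
    funext A
    rw [LinearMap.det_toMatrix]
  rw [h]
  simp only [Matrix.det_apply]
  refine ContDiff.sum fun σ _ => ContDiff.const_smul _ (contDiff_prod fun i _ => ?_)
  let l : (E →L[ℝ] E) →ₗ[ℝ] ℝ :=
    { toFun := fun A => LinearMap.toMatrix v v (A : E →ₗ[ℝ] E) (σ i) i
      map_add' := fun A B => by simp
      map_smul' := fun c A => by simp }
  exact l.toContinuousLinearMap.contDiff

/-- Jacobi's formula at the identity. -/
theorem hasDerivAt_det_one_add_smul [FiniteDimensional ℝ E] (A : E →L[ℝ] E) :
    HasDerivAt (fun h : ℝ => (1 + h • A : E →L[ℝ] E).det)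
      (LinearMap.trace ℝ E (A : E →ₗ[ℝ] E)) 0 := by
  let v := Module.finBasis ℝ E
  set B := LinearMap.toMatrix v v (A : E →ₗ[ℝ] E) with hB
  set P := Matrix.det (1 + (Polynomial.X : Polynomial ℝ) • B.map Polynomial.C) with hP
  have h : (fun h : ℝ => (1 + h • A : E →L[ℝ] E).det) = fun h => P.eval h := by
    funext h
    have h1 : P.eval h = (1 + h • B).det := by
      simp [hP, _root_.eval_det, ← Matrix.smul_eq_mul_diagonal]
    rw [h1, hB, ← LinearMap.toMatrix_one v, ← map_smul, ← map_add, LinearMap.det_toMatrix]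
    rfl
  rw [h]
  have h2 := P.hasDerivAt 0
  rw [hP, Matrix.derivative_det_one_add_X_smul, hB, ← LinearMap.trace_eq_matrix_trace] at h2
  exact h2

/-- Compactness of S gives |G'| < ε on all of S for small h, and the mean value inequality
integrates this. It turns a vanishing derivative at 0 into an o(h) that is uniform on S. -/
theorem eventually_forall_abs_sub_le {X : Type*} [TopologicalSpace X] {G G' : ℝ → X → ℝ}
    {S : Set X} (hS : IsCompact S) (hG : ∀ h x, HasDerivAt (fun s => G s x) (G' h x) h)
    (hG' : Continuous (Function.uncurry G')) (h0 : ∀ x ∈ S, G' 0 x = 0) {ε : ℝ} (hε : 0 < ε) :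
    ∀ᶠ h in 𝓝 (0 : ℝ), ∀ x ∈ S, |G h x - G 0 x| ≤ ε * |h| := by
  have h1 : ∀ᶠ h in 𝓝 (0 : ℝ), ∀ x ∈ S, |G' h x| < ε := by
    refine hS.eventually_forall_of_forall_eventually fun x hx => ?_
    have h2 : ContinuousAt (fun z : ℝ × X => |G' z.1 z.2|) (0, x) := hG'.abs.continuousAt
    refine h2.eventually_lt continuousAt_const ?_
    simpa [h0 x hx] using hε
  obtain ⟨δ, hδ, h2⟩ := Metric.eventually_nhds_iff_ball.1 h1
  filter_upwards [ball_mem_nhds (0 : ℝ) hδ] with h hh x hx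
  have h3 := Convex.norm_image_sub_le_of_norm_hasDerivWithin_le (f := fun s => G s x)
    (f' := fun s => G' s x) (s := ball (0 : ℝ) δ) (x := 0) (y := h) (C := ε)
    (fun s _ => (hG s x).hasDerivWithinAt) (fun s hs => (h2 s hs x hx).le) (convex_ball _ _)
    (mem_ball_self hδ) hh
  simpa using h3

/-- The two locally finite measures agree if they have the same integrals of Lipschitz functions
of compact support. -/
theorem ext_of_integral_lipschitz [FiniteDimensional ℝ E] [MeasurableSpace E] [BorelSpace E]
    {μ ν : Measure E} [IsLocallyFiniteMeasure μ] [IsLocallyFiniteMeasure ν]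
    (h : ∀ f : E → ℝ, (∃ L, LipschitzWith L f) → HasCompactSupport f →
      ∫ x, f x ∂μ = ∫ x, f x ∂ν) : μ = ν := by
  -- Thickened indicators of a compact set are Lipschitz and converge to its indicator, dominated by
  -- the indicator of the closed 1-neighbourhood. So the measures agree on compact sets, and
  -- regularity extends this to open sets and then to all.
  have key : ∀ S : Set E, IsCompact S → ∀ (m : Measure E) [IsLocallyFiniteMeasure m],
      Tendsto (fun k : ℕ => ∫ x, (thickenedIndicator (δ := (1 : ℝ) / (k + 1)) (by positivity) S x : ℝ) ∂m)
        atTop (𝓝 (m.real S)) := by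
    intro S hS m _
    have hT : IsCompact (cthickening 1 S) := hS.cthickening
    rw [← integral_indicator_one hS.measurableSet]
    refine tendsto_integral_of_dominated_convergence ((cthickening 1 S).indicator 1) ?_ ?_ ?_ ?_
    · intro k
      exact (NNReal.continuous_coe.comp (thickenedIndicator _ S).continuous).aestronglyMeasurable
    · exact (continuousOn_const.integrableOn_compact hT).integrable_indicator hT.measurableSet
    · intro k
      refine ae_of_all _ fun x => ?_
      have hk : (1 : ℝ) / (k + 1) ≤ 1 := by
        rw [div_le_one (by positivity)]
        linarith [(Nat.cast_nonneg k : (0 : ℝ) ≤ k)]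
      by_cases hx : x ∈ cthickening 1 S
      · rw [Set.indicator_of_mem hx]
        simp only [Pi.one_apply, Real.norm_eq_abs, NNReal.abs_eq]
        exact_mod_cast thickenedIndicator_le_one (by positivity) S x
      · rw [Set.indicator_of_notMem hx, thickenedIndicator_zero]
        · simp
        · exact fun h => hx (thickening_subset_cthickening _ _ (thickening_mono hk S h))
    · refine ae_of_all _ fun x => ?_
      have h1 := thickenedIndicator_tendsto_indicator_closure
        (δseq := fun k : ℕ => (1 : ℝ) / (k + 1)) (fun k => by positivity)
        tendsto_one_div_add_atTop_nhds_zero_nat S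
      rw [tendsto_pi_nhds] at h1
      have h2 := (NNReal.tendsto_coe.2 (h1 x))
      rw [hS.isClosed.closure_eq] at h2
      convert h2 using 2
      by_cases hx : x ∈ S <;> simp [hx]
  apply Measure.OuterRegular.ext_isOpen
  apply Measure.InnerRegularWRT.eq_of_innerRegularWRT_of_forall_eq
    (Measure.Regular.innerRegular (μ := μ)) (Measure.Regular.innerRegular (μ := ν))
  intro S hS
  have h3 : μ.real S = ν.real S := by
    refine tendsto_nhds_unique (key S hS μ) ((key S hS ν).congr fun k => (h _ ?_ ?_).symm)
    · exact ⟨_, (NNReal.isometry_coe.lipschitz).comp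
        (lipschitzWith_thickenedIndicator (δ := (1 : ℝ) / (k + 1)) (by positivity) S)⟩
    · refine HasCompactSupport.intro (hS.cthickening (r := (1 : ℝ) / (k + 1))) fun x hx => ?_
      rw [thickenedIndicator_zero]
      · simp
      · exact fun h => hx (thickening_subset_cthickening _ _ h)
  exact (measureReal_eq_measureReal_iff hS.measure_ne_top hS.measure_ne_top).1 h3

end Liouville

end Chaplygin
namespace Chaplygin

/-! ### Liouville's theorem for fields of compact support -/

section LiouvilleTheorem

open Set Filter Topology NNReal

variable {E : Type*} [NormedAddCommGroup E] [NormedSpace ℝ E]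

theorem continuousLinearMap_det_one : (1 : E →L[ℝ] E).det = 1 := LinearMap.det_id

variable [FiniteDimensional ℝ E]

theorem bijective_add_smul {Y : E → E} {K : ℝ≥0} (hY : LipschitzWith K Y) {h : ℝ}
    (hh : K * |h| < 1) : Function.Bijective fun x => x + h • Y x := by
  -- The zero space is separate because the identity has norm 1 only on a nontrivial space.
  rcases subsingleton_or_nontrivial E with hE | hE
  · exact ⟨Function.injective_of_subsingleton _, fun y => ⟨y, Subsingleton.elim _ _⟩⟩
  have h1 : ApproximatesLinearOn (fun x => x + h • Y x)
      ((ContinuousLinearEquiv.refl ℝ E : E ≃L[ℝ] E) : E →L[ℝ] E) univ (K * ‖h‖₊) := by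
    intro x _ y _
    have : (x + h • Y x) - (y + h • Y y) - (x - y) = h • (Y x - Y y) := by
      rw [smul_sub]
      abel
    rw [ContinuousLinearEquiv.coe_refl, ContinuousLinearMap.coe_id', id, this, norm_smul,
      NNReal.coe_mul, coe_nnnorm, mul_comm (K : ℝ), mul_assoc]
    exact mul_le_mul_of_nonneg_left (hY.norm_sub_le x y) (norm_nonneg h)
  have h2 : K * ‖h‖₊ <
      ‖((ContinuousLinearEquiv.refl ℝ E).symm : E →L[ℝ] E)‖₊⁻¹ := by
    have h3 : ‖((ContinuousLinearEquiv.refl ℝ E).symm : E →L[ℝ] E)‖₊ = 1 := by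
      ext
      simp
    rw [h3, inv_one, ← NNReal.coe_lt_coe]
    simpa using hh
  exact ⟨injOn_univ.1 (h1.injOn (Or.inr h2)), h1.surjective (Or.inr h2)⟩

variable {Y : E → E} {φ : ℝ → E → E} {ρ : E → ℝ}

/-- The Jacobian of the Euler step, with weight, agrees with `ρ` to first order. -/
theorem eventually_jacobian_sub_le (hY : ContDiff ℝ 1 Y) (hρ : ContDiff ℝ 1 ρ)
    (hdiv : ∀ x, fderiv ℝ ρ x (Y x) +
      ρ x * LinearMap.trace ℝ E (fderiv ℝ Y x : E →ₗ[ℝ] E) = 0)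
    {S : Set E} (hS : IsCompact S) {ε : ℝ} (hε : 0 < ε) :
    ∀ᶠ h in 𝓝 (0 : ℝ), ∀ x ∈ S,
      |ρ (x + h • Y x) * |(1 + h • fderiv ℝ Y x : E →L[ℝ] E).det| - ρ x| ≤ ε * |h| := by
  have hY' : Continuous (fderiv ℝ Y) := hY.continuous_fderiv one_ne_zero
  have hρ' : Continuous (fderiv ℝ ρ) := hρ.continuous_fderiv one_ne_zero
  have hD : ContDiff ℝ 1 (fun A : E →L[ℝ] E => A.det) := contDiff_det
  have hD' := hD.continuous_fderiv one_ne_zero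
  have hcY := hY.continuous
  have hcρ := hρ.continuous
  -- For small h the determinant is positive, so the absolute value can be dropped and the weighted
  -- Jacobian becomes differentiable in h. Its derivative at h = 0 is the left side of `hdiv`.
  have hpos : ∀ᶠ h in 𝓝 (0 : ℝ), ∀ x ∈ S, 0 < (1 + h • fderiv ℝ Y x : E →L[ℝ] E).det := by
    refine hS.eventually_forall_of_forall_eventually fun x _ => ?_
    have h2 : Continuous (fun z : ℝ × E => (1 + z.1 • fderiv ℝ Y z.2 : E →L[ℝ] E).det) :=
      hD.continuous.comp (by fun_prop)
    refine continuousAt_const.eventually_lt h2.continuousAt ?_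
    simp [continuousLinearMap_det_one]
  have hderiv : ∀ (h : ℝ) (x : E), HasDerivAt
      (fun s : ℝ => ρ (x + s • Y x) * (1 + s • fderiv ℝ Y x : E →L[ℝ] E).det)
      (fderiv ℝ ρ (x + h • Y x) (Y x) * (1 + h • fderiv ℝ Y x : E →L[ℝ] E).det +
        ρ (x + h • Y x) * fderiv ℝ (fun A : E →L[ℝ] E => A.det) (1 + h • fderiv ℝ Y x)
          (fderiv ℝ Y x)) h := by
    intro h x
    have e1 : HasDerivAt (fun s : ℝ => x + s • Y x) (Y x) h := by
      simpa using ((hasDerivAt_id h).smul_const (Y x)).const_add x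
    have e2 : HasDerivAt (fun s : ℝ => (1 + s • fderiv ℝ Y x : E →L[ℝ] E)) (fderiv ℝ Y x) h := by
      simpa using ((hasDerivAt_id h).smul_const (fderiv ℝ Y x)).const_add (1 : E →L[ℝ] E)
    have f1 := ((hρ.differentiable one_ne_zero) (x + h • Y x)).hasFDerivAt.comp_hasDerivAt h e1
    have f2 := ((hD.differentiable one_ne_zero) (1 + h • fderiv ℝ Y x)).hasFDerivAt.comp_hasDerivAt
      h e2
    exact f1.mul f2
  have hzero : ∀ x, fderiv ℝ (fun A : E →L[ℝ] E => A.det) (1 + (0 : ℝ) • fderiv ℝ Y x)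
          (fderiv ℝ Y x) = LinearMap.trace ℝ E (fderiv ℝ Y x : E →ₗ[ℝ] E) := by
    intro x
    have e2 : HasDerivAt (fun s : ℝ => (1 + s • fderiv ℝ Y x : E →L[ℝ] E)) (fderiv ℝ Y x) 0 := by
      simpa using ((hasDerivAt_id (0 : ℝ)).smul_const (fderiv ℝ Y x)).const_add (1 : E →L[ℝ] E)
    have f2 := ((hD.differentiable one_ne_zero)
      (1 + (0 : ℝ) • fderiv ℝ Y x)).hasFDerivAt.comp_hasDerivAt 0 e2
    exact f2.unique (hasDerivAt_det_one_add_smul _)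
  have hmain := eventually_forall_abs_sub_le hS hderiv (by
      have c1 : Continuous (fun z : ℝ × E => (1 + z.1 • fderiv ℝ Y z.2 : E →L[ℝ] E)) := by fun_prop
      have c2 : Continuous (fun z : ℝ × E => z.2 + z.1 • Y z.2) := by fun_prop
      have c3 : Continuous (fun z : ℝ × E => Y z.2) := by fun_prop
      have c4 : Continuous (fun z : ℝ × E => fderiv ℝ Y z.2) := by fun_prop
      exact (((hρ'.comp c2).clm_apply c3).mul (hD.continuous.comp c1)).add
        ((hcρ.comp c2).mul ((hD'.comp c1).clm_apply c4))) (fun x _ => by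
      rw [hzero]
      simpa [continuousLinearMap_det_one] using hdiv x) hε
  filter_upwards [hmain, hpos] with h h1 h2 x hx
  have h3 := h1 x hx
  rw [abs_of_pos (h2 x hx)]
  simpa [continuousLinearMap_det_one] using h3

variable [MeasurableSpace E] [BorelSpace E] (μ : Measure E) [μ.IsAddHaarMeasure]

theorem integral_comp_add_smul {K : ℝ≥0} (hY : LipschitzWith K Y)
    (hd : Differentiable ℝ Y) {h : ℝ} (hh : K * |h| < 1) (g : E → ℝ) :
    ∫ x, |(1 + h • fderiv ℝ Y x : E →L[ℝ] E).det| * g (x + h • Y x) ∂μ = ∫ x, g x ∂μ := by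
  have hb := bijective_add_smul hY hh
  have h1 := integral_image_eq_integral_abs_det_fderiv_smul (s := univ) μ MeasurableSet.univ
    (f := fun x => x + h • Y x) (f' := fun x => (1 + h • fderiv ℝ Y x : E →L[ℝ] E))
    (fun x _ => ((hasFDerivAt_id x).add
      ((hd x).hasFDerivAt.const_smul h)).hasFDerivWithinAt) hb.1.injOn g
  rw [image_univ, hb.2.range_eq, setIntegral_univ, setIntegral_univ] at h1
  simpa using h1.symm

/-- Replacing φ_h by the Euler step costs O(h²), and the Euler step changes ∫ gρ by o(h), by
substitution and `eventually_jacobian_sub_le`. Outside the support of Y both maps are the identity,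
so only a compact set contributes. -/
theorem eventually_integral_flow_sub_le (hφ : IsGlobalFlow Y φ) (hY : ContDiff ℝ 1 Y)
    (hYc : HasCompactSupport Y) (hρ : ContDiff ℝ 1 ρ)
    (hdiv : ∀ x, fderiv ℝ ρ x (Y x) +
      ρ x * LinearMap.trace ℝ E (fderiv ℝ Y x : E →ₗ[ℝ] E) = 0)
    {g : E → ℝ} {L : ℝ≥0} (hg : LipschitzWith L g) (hgc : HasCompactSupport g)
    {ε : ℝ} (hε : 0 < ε) :
    ∀ᶠ h in 𝓝 (0 : ℝ), |∫ x, g (φ h x) * ρ x ∂μ - ∫ x, g x * ρ x ∂μ| ≤ ε * |h| := by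
  obtain ⟨K, hK⟩ := hY.lipschitzWith_of_hasCompactSupport hYc one_ne_zero
  obtain ⟨C₀, hC₀⟩ := hYc.exists_bound_of_continuous hY.continuous
  obtain ⟨B, hB⟩ := hgc.exists_bound_of_continuous hg.continuous
  set C : ℝ≥0 := C₀.toNNReal
  have hC : ∀ x, ‖Y x‖ ≤ C := fun x => (hC₀ x).trans (Real.le_coe_toNNReal _)
  set S := tsupport Y
  have hS : IsCompact S := hYc
  have hY0 : ∀ x, x ∉ S → Y x = 0 := fun x hx => image_eq_zero_of_notMem_tsupport hx
  have hD0 : ∀ x, x ∉ S → fderiv ℝ Y x = 0 := fun x hx => fderiv_of_notMem_tsupport _ hx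
  obtain ⟨R, hR⟩ := hS.exists_bound_of_continuousOn hρ.continuous.continuousOn
  have hB0 : 0 ≤ B := (norm_nonneg _).trans (hB 0)
  set m := μ.real S
  have hm : 0 ≤ m := measureReal_nonneg
  -- Half of ε pays for the Jacobian error B * ε₁ * m. The summand 1 keeps the denominator positive
  -- when B * m = 0.
  set ε₁ := ε / (2 * (B * m + 1))
  have hε₁ : 0 < ε₁ := by positivity
  have hJ := eventually_jacobian_sub_le hY hρ hdiv hS hε₁
  have hsmall : ∀ᶠ h in 𝓝 (0 : ℝ), L * K * C * |R| * m * |h| ≤ ε / 2 := by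
    have : Continuous fun h : ℝ => L * K * C * |R| * m * |h| := by fun_prop
    refine (this.continuousAt.eventually_lt continuousAt_const ?_).mono fun _ => le_of_lt
    simpa using hε
  have hK1 : ∀ᶠ h in 𝓝 (0 : ℝ), (K : ℝ) * |h| < 1 := by
    have : Continuous fun h : ℝ => (K : ℝ) * |h| := by fun_prop
    refine this.continuousAt.eventually_lt continuousAt_const ?_
    simp
  have hY' : Continuous (fderiv ℝ Y) := hY.continuous_fderiv one_ne_zero
  have hcY := hY.continuous
  have hcρ := hρ.continuous
  have hcg := hg.continuous
  filter_upwards [hJ, hsmall, hK1] with h h1 h2 h3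
  have hφc : Continuous (φ h) := (hφ.exists_lipschitzWith hK h).choose_spec.continuous
  rw [← integral_comp_add_smul μ hK (hY.differentiable one_ne_zero) h3 (fun x => g x * ρ x)]
  have hi1 : Integrable (fun x => g (φ h x) * ρ x) μ := by
    refine Continuous.integrable_of_hasCompactSupport (by fun_prop)
      (HasCompactSupport.intro (hS.union hgc) fun x hx => ?_)
    rw [hφ.eq_self_of_eq_zero hK (hY0 x fun h => hx (Or.inl h)),
      image_eq_zero_of_notMem_tsupport fun h => hx (Or.inr h), zero_mul]
  have hi2 : Integrable (fun x => |(1 + h • fderiv ℝ Y x : E →L[ℝ] E).det| *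
      (g (x + h • Y x) * ρ (x + h • Y x))) μ := by
    have hcd : Continuous (fun x => (1 + h • fderiv ℝ Y x : E →L[ℝ] E).det) :=
      (contDiff_det (m := 1)).continuous.comp (by fun_prop)
    refine Continuous.integrable_of_hasCompactSupport (by fun_prop)
      (HasCompactSupport.intro (hS.union hgc) fun x hx => ?_)
    rw [hY0 x fun h => hx (Or.inl h), smul_zero, add_zero,
      image_eq_zero_of_notMem_tsupport fun h => hx (Or.inr h), zero_mul, mul_zero]
  rw [← integral_sub hi1 hi2]
  have hbound : ∀ x ∈ S, ‖g (φ h x) * ρ x - |(1 + h • fderiv ℝ Y x : E →L[ℝ] E).det| *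
      (g (x + h • Y x) * ρ (x + h • Y x))‖ ≤
      (L * K * C * |R| * |h| + B * ε₁) * |h| := by
    intro x hx
    have e : g (φ h x) * ρ x - |(1 + h • fderiv ℝ Y x : E →L[ℝ] E).det| *
        (g (x + h • Y x) * ρ (x + h • Y x)) =
        (g (φ h x) - g (x + h • Y x)) * ρ x - g (x + h • Y x) *
          (ρ (x + h • Y x) * |(1 + h • fderiv ℝ Y x : E →L[ℝ] E).det| - ρ x) := by ring
    rw [e]
    refine (norm_sub_le _ _).trans ?_
    rw [norm_mul, norm_mul, add_mul]
    refine add_le_add ?_ ?_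
    · have a1 := (hg.norm_sub_le (φ h x) (x + h • Y x)).trans
        (mul_le_mul_of_nonneg_left (hφ.norm_sub_euler_le hK hC x h) L.2)
      have a2 : ‖ρ x‖ ≤ |R| := (hR x hx).trans (le_abs_self R)
      refine (mul_le_mul a1 a2 (norm_nonneg _) (by positivity)).trans (le_of_eq ?_)
      ring
    · rw [mul_assoc]
      exact mul_le_mul (hB _) (h1 x hx) (norm_nonneg _) hB0
  have hzero : ∀ x, x ∉ S → g (φ h x) * ρ x - |(1 + h • fderiv ℝ Y x : E →L[ℝ] E).det| *
      (g (x + h • Y x) * ρ (x + h • Y x)) = 0 := by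
    intro x hx
    rw [hφ.eq_self_of_eq_zero hK (hY0 x hx), hY0 x hx, hD0 x hx]
    simp [continuousLinearMap_det_one]
  rw [← setIntegral_eq_integral_of_forall_compl_eq_zero hzero]
  refine (norm_setIntegral_le_of_norm_le_const hS.measure_lt_top hbound).trans ?_
  have e2 : B * ε₁ * m ≤ ε / 2 := by
    have : ε₁ * (B * m + 1) = ε / 2 := by
      simp only [ε₁]
      field_simp
    nlinarith
  calc (L * K * C * |R| * |h| + B * ε₁) * |h| * m
      = (L * K * C * |R| * m * |h| + B * ε₁ * m) * |h| := by ring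
    _ ≤ (ε / 2 + ε / 2) * |h| := by gcongr
    _ = ε * |h| := by ring

/-- By the group law, the derivative at time s is the derivative at time 0 for the test function f ∘
φ_s, which is again Lipschitz with compact support. So it vanishes at every s. -/
theorem integral_comp_flow (hφ : IsGlobalFlow Y φ) (hY : ContDiff ℝ 1 Y)
    (hYc : HasCompactSupport Y) (hρ : ContDiff ℝ 1 ρ)
    (hdiv : ∀ x, fderiv ℝ ρ x (Y x) +
      ρ x * LinearMap.trace ℝ E (fderiv ℝ Y x : E →ₗ[ℝ] E) = 0)
    {f : E → ℝ} {L : ℝ≥0} (hf : LipschitzWith L f) (hfc : HasCompactSupport f) (t : ℝ) :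
    ∫ x, f (φ t x) * ρ x ∂μ = ∫ x, f x * ρ x ∂μ := by
  obtain ⟨K, hK⟩ := hY.lipschitzWith_of_hasCompactSupport hYc one_ne_zero
  have hd : ∀ s, HasDerivAt (fun r => ∫ x, f (φ r x) * ρ x ∂μ) 0 s := by
    intro s
    obtain ⟨L', hL'⟩ := hφ.exists_lipschitzWith hK s
    have hgc : HasCompactSupport (f ∘ φ s) := by
      refine HasCompactSupport.intro (IsCompact.union hYc hfc) fun x hx => ?_
      rw [Function.comp_apply, hφ.eq_self_of_eq_zero hK
        (image_eq_zero_of_notMem_tsupport fun h => hx (Or.inl h)),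
        image_eq_zero_of_notMem_tsupport fun h => hx (Or.inr h)]
    rw [hasDerivAt_iff_isLittleO_nhds_zero, Asymptotics.isLittleO_iff]
    intro ε hε
    filter_upwards [eventually_integral_flow_sub_le μ hφ hY hYc hρ hdiv (hf.comp hL') hgc hε]
      with h hh
    simpa [hφ.map_add hK s h] using hh
  have h1 := is_const_of_deriv_eq_zero (fun s => (hd s).differentiableAt)
    (fun s => (hd s).deriv) t 0
  simpa [hφ.zero] using h1

end LiouvilleTheorem

end Chaplygin
namespace Chaplygin

/-! ### Fields with a proper first integral: completeness and Liouville's theorem -/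

section FirstIntegral

open Set Filter Topology NNReal

variable {E : Type*} [NormedAddCommGroup E] [NormedSpace ℝ E]

/-- The vector field `X` multiplied by a smooth function of `N` that is `1` for `N ≤ R` and `0` for
`R + 1 ≤ N`. -/
noncomputable def cutoff (N : E → ℝ) (X : E → E) (R : ℝ) (x : E) : E :=
  Real.smoothTransition (R + 1 - N x) • X x

theorem cutoff_of_le {N : E → ℝ} {X : E → E} {R : ℝ} {x : E} (h : N x ≤ R) :
    cutoff N X R x = X x := by
  rw [cutoff, Real.smoothTransition.one_of_one_le (by linarith), one_smul]

theorem cutoff_of_ge {N : E → ℝ} {X : E → E} {R : ℝ} {x : E} (h : R + 1 ≤ N x) :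
    cutoff N X R x = 0 := by
  rw [cutoff, Real.smoothTransition.zero_of_nonpos (by linarith), zero_smul]

/-- `N` is a first integral of the continuously differentiable vector field `X`, and its sublevel
sets are compact. -/
structure IsProperFirstIntegral (X : E → E) (N : E → ℝ) : Prop where
  contDiff_field : ContDiff ℝ 1 X
  contDiff : ContDiff ℝ 1 N
  isCompact : ∀ R, IsCompact {x | N x ≤ R}
  fderiv_apply : ∀ x, fderiv ℝ N x (X x) = 0

namespace IsProperFirstIntegral

variable {X : E → E} {N : E → ℝ} {ρ : E → ℝ}

theorem contDiff_cutoff (h : IsProperFirstIntegral X N) (R : ℝ) : ContDiff ℝ 1 (cutoff N X R) :=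
  (Real.smoothTransition.contDiff.comp (contDiff_const.sub h.contDiff)).smul h.contDiff_field

theorem hasCompactSupport_cutoff (h : IsProperFirstIntegral X N) (R : ℝ) :
    HasCompactSupport (cutoff N X R) :=
  HasCompactSupport.intro (h.isCompact (R + 1)) fun _ hx => cutoff_of_ge (not_le.1 hx).le

theorem exists_lipschitzWith_cutoff (h : IsProperFirstIntegral X N) (R : ℝ) :
    ∃ K, LipschitzWith K (cutoff N X R) :=
  (h.contDiff_cutoff R).lipschitzWith_of_hasCompactSupport (h.hasCompactSupport_cutoff R)
    one_ne_zero

/-- The factor r allows the same argument for X and for its cutoffs. -/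
theorem conserved_of_smul (h : IsProperFirstIntegral X N) {c : ℝ → E} {r : ℝ → ℝ}
    (hc : ∀ t, HasDerivAt c (r t • X (c t)) t) (t : ℝ) : N (c t) = N (c 0) := by
  have hd : ∀ s, HasDerivAt (fun s => N (c s)) 0 s := fun s => by
    have := ((h.contDiff.differentiable one_ne_zero) (c s)).hasFDerivAt.comp_hasDerivAt s (hc s)
    rwa [map_smul, h.fderiv_apply, smul_zero] at this
  exact is_const_of_deriv_eq_zero (fun s => (hd s).differentiableAt) (fun s => (hd s).deriv) t 0

theorem conserved (h : IsProperFirstIntegral X N) {c : ℝ → E}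
    (hc : ∀ t, HasDerivAt c (X (c t)) t) (t : ℝ) : N (c t) = N (c 0) :=
  h.conserved_of_smul (r := fun _ => 1) (fun t => by simpa using hc t) t

theorem conserved_cutoff (h : IsProperFirstIntegral X N) {R : ℝ} {φ : ℝ → E → E}
    (hφ : IsGlobalFlow (cutoff N X R) φ) (t : ℝ) (x : E) : N (φ t x) = N x := by
  have := h.conserved_of_smul (c := fun s => φ s x) (fun t => hφ.hasDerivAt x t) t
  simpa [hφ.zero] using this

theorem eq_cutoff_flow (h : IsProperFirstIntegral X N) {R : ℝ} {φ : ℝ → E → E}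
    (hφ : IsGlobalFlow (cutoff N X R) φ) {c : ℝ → E} (hc : ∀ t, HasDerivAt c (X (c t)) t)
    (hR : N (c 0) ≤ R) (t : ℝ) : c t = φ t (c 0) := by
  obtain ⟨K, hK⟩ := h.exists_lipschitzWith_cutoff R
  refine hφ.eq_of_hasDerivAt hK (fun t => ?_) t
  rw [cutoff_of_le (by rwa [h.conserved hc t])]
  exact hc t

theorem exists_cutoff_flow [CompleteSpace E] (h : IsProperFirstIntegral X N) (R : ℝ) :
    ∃ φ, IsGlobalFlow (cutoff N X R) φ := by
  obtain ⟨K, hK⟩ := h.exists_lipschitzWith_cutoff R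
  obtain ⟨C, hC⟩ := (h.hasCompactSupport_cutoff R).exists_bound_of_continuous
    (h.contDiff_cutoff R).continuous
  exact exists_isGlobalFlow hK (C := C.toNNReal) fun x => (hC x).trans (Real.le_coe_toNNReal _)

theorem exists_isGlobalFlow [CompleteSpace E] (h : IsProperFirstIntegral X N) :
    ∃ φ, IsGlobalFlow X φ := by
  choose φ hφ using h.exists_cutoff_flow
  -- Each point uses the cutoff at its own level. Its trajectory stays on that level, where the
  -- cutoff field equals X.
  refine ⟨fun t x => φ (N x) t x, fun x => (hφ _).zero x, fun x t => ?_⟩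
  have := (hφ (N x)).hasDerivAt x t
  rwa [cutoff_of_le (h.conserved_cutoff (hφ _) t x).le] at this

theorem eq_flow [CompleteSpace E] (h : IsProperFirstIntegral X N) {φ : ℝ → E → E}
    (hφ : IsGlobalFlow X φ) {c : ℝ → E} (hc : ∀ t, HasDerivAt c (X (c t)) t) (t : ℝ) :
    c t = φ t (c 0) := by
  obtain ⟨ψ, hψ⟩ := h.exists_cutoff_flow (N (c 0))
  have h1 := h.eq_cutoff_flow hψ (hφ.hasDerivAt (c 0)) (by rw [hφ.zero]) t
  rw [h.eq_cutoff_flow hψ hc le_rfl, h1, hφ.zero]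

theorem flow_eq_cutoff_flow (h : IsProperFirstIntegral X N) {φ ψ : ℝ → E → E} {R : ℝ}
    (hφ : IsGlobalFlow X φ) (hψ : IsGlobalFlow (cutoff N X R) ψ) {x : E} (hx : N x ≤ R) (t : ℝ) :
    φ t x = ψ t x := by
  have h1 := h.eq_cutoff_flow hψ (hφ.hasDerivAt x) (by rwa [hφ.zero]) t
  simpa only [hφ.zero] using h1

theorem conserved_flow (h : IsProperFirstIntegral X N) {φ : ℝ → E → E}
    (hφ : IsGlobalFlow X φ) (t : ℝ) (x : E) : N (φ t x) = N x := by
  simpa [hφ.zero] using h.conserved (hφ.hasDerivAt x) t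

theorem continuous_flow [CompleteSpace E] (h : IsProperFirstIntegral X N) {φ : ℝ → E → E}
    (hφ : IsGlobalFlow X φ) (t : ℝ) : Continuous (φ t) := by
  refine continuous_iff_continuousAt.2 fun x => ?_
  obtain ⟨ψ, hψ⟩ := h.exists_cutoff_flow (N x + 1)
  obtain ⟨K, hK⟩ := h.exists_lipschitzWith_cutoff (N x + 1)
  obtain ⟨L, hL⟩ := hψ.exists_lipschitzWith hK t
  refine hL.continuous.continuousAt.congr ?_
  have h1 : ∀ᶠ y in 𝓝 x, N y < N x + 1 :=
    h.contDiff.continuous.continuousAt.eventually_lt continuousAt_const (lt_add_one _)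
  filter_upwards [h1] with y hy
  exact (h.flow_eq_cutoff_flow hφ hψ hy.le t).symm

variable [FiniteDimensional ℝ E]

/-- Multiplying X by a function of N adds to the divergence only a multiple of dN(X) = 0; the rest
is the hypothesis times the cutoff factor. -/
theorem divergence_cutoff (h : IsProperFirstIntegral X N)
    (hdiv : ∀ x, fderiv ℝ ρ x (X x) +
      ρ x * LinearMap.trace ℝ E (fderiv ℝ X x : E →ₗ[ℝ] E) = 0) (R : ℝ) (x : E) :
    fderiv ℝ ρ x (cutoff N X R x) +
      ρ x * LinearMap.trace ℝ E (fderiv ℝ (cutoff N X R) x : E →ₗ[ℝ] E) = 0 := by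
  have h1 : DifferentiableAt ℝ X x := h.contDiff_field.differentiable one_ne_zero x
  have hN := (h.contDiff.differentiable one_ne_zero x).hasFDerivAt
  have hT : HasDerivAt Real.smoothTransition (deriv Real.smoothTransition (R + 1 - N x))
      (R + 1 - N x) :=
    ((Real.smoothTransition.contDiff (n := 1)).differentiable one_ne_zero _).hasDerivAt
  have h3 := (hT.comp_hasFDerivAt x (hN.const_sub (R + 1))).smul h1.hasFDerivAt
  have h4 : fderiv ℝ (cutoff N X R) x = _ := h3.fderiv
  rw [h4]
  have h5 : LinearMap.trace ℝ E ((((deriv Real.smoothTransition (R + 1 - N x)) •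
      (-fderiv ℝ N x)).smulRight (X x) : E →L[ℝ] E) : E →ₗ[ℝ] E) = 0 := by
    have e : ((((deriv Real.smoothTransition (R + 1 - N x)) •
      (-fderiv ℝ N x)).smulRight (X x) : E →L[ℝ] E) : E →ₗ[ℝ] E) =
      (((deriv Real.smoothTransition (R + 1 - N x)) •
      (-fderiv ℝ N x) : E →L[ℝ] ℝ) : E →ₗ[ℝ] ℝ).smulRight (X x) := rfl
    rw [e, LinearMap.trace_smulRight]
    simp [h.fderiv_apply]
  rw [ContinuousLinearMap.toLinearMap_add, map_add, h5, add_zero,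
    ContinuousLinearMap.toLinearMap_smul, map_smul, cutoff, map_smul, smul_eq_mul, smul_eq_mul,
    Function.comp_apply]
  linear_combination Real.smoothTransition (R + 1 - N x) * hdiv x

variable [MeasurableSpace E] [BorelSpace E] (μ : Measure E) [μ.IsAddHaarMeasure]

/-- Liouville's theorem: a flow preserves the measure `ρ dx` if the divergence of `ρ X` is zero. -/
theorem measurePreserving_flow (h : IsProperFirstIntegral X N) {φ : ℝ → E → E}
    (hφ : IsGlobalFlow X φ) (hρ : ContDiff ℝ 1 ρ) (hρ0 : ∀ x, 0 ≤ ρ x)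
    (hdiv : ∀ x, fderiv ℝ ρ x (X x) +
      ρ x * LinearMap.trace ℝ E (fderiv ℝ X x : E →ₗ[ℝ] E) = 0) (t : ℝ) :
    MeasurePreserving (φ t) (μ.withDensity fun x => ENNReal.ofReal (ρ x))
      (μ.withDensity fun x => ENNReal.ofReal (ρ x)) := by
  have hcont := h.continuous_flow hφ t
  have hρc := hρ.continuous
  set m := μ.withDensity fun x => ENNReal.ofReal (ρ x) with hm
  have hml : IsLocallyFiniteMeasure m :=
    IsLocallyFiniteMeasure.withDensity_ofReal hρc
  -- Since N is conserved, the preimage of a compact set lies in a sublevel set of N, which is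
  -- compact and so of finite measure.
  have hml' : IsLocallyFiniteMeasure (m.map (φ t)) := by
    have : IsFiniteMeasureOnCompacts (m.map (φ t)) := by
      refine ⟨fun S hS => ?_⟩
      rw [Measure.map_apply hcont.measurable hS.measurableSet]
      obtain ⟨R, hR⟩ := hS.exists_bound_of_continuousOn h.contDiff.continuous.continuousOn
      refine (measure_mono (t := {x | N x ≤ R}) fun x hx => ?_).trans_lt
        (h.isCompact R).measure_lt_top
      have := hR _ hx
      rw [h.conserved_flow hφ] at this
      exact (le_abs_self _).trans this
    infer_instance
  refine ⟨hcont.measurable, ext_of_integral_lipschitz fun f ⟨L, hL⟩ hfc => ?_⟩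
  rw [integral_map hcont.measurable.aemeasurable hL.continuous.aestronglyMeasurable]
  have hw : ∀ g : E → ℝ, ∫ x, g x ∂m = ∫ x, g x * ρ x ∂μ := by
    intro g
    rw [hm, integral_withDensity_eq_integral_toReal_smul hρc.measurable.ennreal_ofReal
      (ae_of_all _ fun x => ENNReal.ofReal_lt_top)]
    refine integral_congr_ae (ae_of_all _ fun x => ?_)
    simp [ENNReal.toReal_ofReal (hρ0 x), mul_comm]
  rw [hw, hw]
  obtain ⟨R, hR⟩ := IsCompact.exists_bound_of_continuousOn hfc h.contDiff.continuous.continuousOn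
  obtain ⟨ψ, hψ⟩ := h.exists_cutoff_flow R
  rw [← integral_comp_flow μ hψ (h.contDiff_cutoff R) (h.hasCompactSupport_cutoff R) hρ
    (h.divergence_cutoff hdiv R) hL hfc t]
  congr 1
  funext x
  -- On N ≤ R the two flows coincide. Elsewhere both keep x on its level of N, which misses the
  -- support of f.
  by_cases hx : N x ≤ R
  · rw [h.flow_eq_cutoff_flow hφ hψ hx]
  · have h0 : ∀ y, N y = N x → f y = 0 := fun y hy =>
      image_eq_zero_of_notMem_tsupport fun hy' =>
        hx (hy ▸ (le_abs_self _).trans (hR y hy'))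
    rw [h0 _ (h.conserved_flow hφ t x), h0 _ (h.conserved_cutoff hψ t x)]

end IsProperFirstIntegral

end FirstIntegral

end Chaplygin
namespace Chaplygin

noncomputable section

/-! ### Trace identities and abstract contact systems -/

section Abstract

open Set Filter Topology
open scoped RealInnerProductSpace

section Trace

variable {F : Type*} [NormedAddCommGroup F] [InnerProductSpace ℝ F] [FiniteDimensional ℝ F]

theorem trace_eq_of_inner {A B : F →ₗ[ℝ] F} (h : ∀ x y, ⟪A x, y⟫ = ⟪x, B y⟫) :
    LinearMap.trace ℝ F A = LinearMap.trace ℝ F B := by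
  rw [LinearMap.trace_eq_sum_inner A (stdOrthonormalBasis ℝ F),
    LinearMap.trace_eq_sum_inner B (stdOrthonormalBasis ℝ F)]
  exact Finset.sum_congr rfl fun i _ => by rw [← h, real_inner_comm]

/-- The adjoint of AB is -BA, so tr(AB) = -tr(BA) = -tr(AB). -/
theorem trace_skew_comp_symm {A B : F →ₗ[ℝ] F} (hA : ∀ x y, ⟪A x, y⟫ = -⟪x, A y⟫)
    (hB : ∀ x y, ⟪B x, y⟫ = ⟪x, B y⟫) : LinearMap.trace ℝ F (A ∘ₗ B) = 0 := by
  have h : LinearMap.trace ℝ F (A ∘ₗ B) = LinearMap.trace ℝ F (-(B ∘ₗ A)) :=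
    trace_eq_of_inner fun x y => by simp [hA, hB]
  rw [map_neg, LinearMap.trace_comp_comm' A B] at h
  linarith

theorem trace_skew {A : F →ₗ[ℝ] F} (hA : ∀ x y, ⟪A x, y⟫ = -⟪x, A y⟫) :
    LinearMap.trace ℝ F A = 0 :=
  trace_skew_comp_symm (B := LinearMap.id) hA fun _ _ => rfl

end Trace

theorem trace_prod {F G : Type*} [AddCommGroup F] [Module ℝ F] [AddCommGroup G] [Module ℝ G]
    [FiniteDimensional ℝ F] [FiniteDimensional ℝ G] (f : F × G →ₗ[ℝ] F × G) :
    LinearMap.trace ℝ (F × G) f =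
      LinearMap.trace ℝ F (LinearMap.fst ℝ F G ∘ₗ f ∘ₗ LinearMap.inl ℝ F G) +
      LinearMap.trace ℝ G (LinearMap.snd ℝ F G ∘ₗ f ∘ₗ LinearMap.inr ℝ F G) := by
  have h : f = (f ∘ₗ LinearMap.inl ℝ F G) ∘ₗ LinearMap.fst ℝ F G +
      (f ∘ₗ LinearMap.inr ℝ F G) ∘ₗ LinearMap.snd ℝ F G := by
    refine LinearMap.ext fun x => ?_
    simp only [LinearMap.add_apply, LinearMap.comp_apply, ← map_add]
    simp
  conv_lhs => rw [h, map_add, LinearMap.trace_comp_comm', LinearMap.trace_comp_comm'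
    (LinearMap.snd ℝ F G)]

/-- Jacobi's formula. -/
theorem hasDerivAt_det_add_smul {F : Type*} [NormedAddCommGroup F] [NormedSpace ℝ F]
    [FiniteDimensional ℝ F] {A A' : F →L[ℝ] F} (hA : A * A' = 1) (B : F →L[ℝ] F) :
    HasDerivAt (fun h : ℝ => (A + h • B).det)
      (A.det * LinearMap.trace ℝ F ((A' * B : F →L[ℝ] F) : F →ₗ[ℝ] F)) 0 := by
  have h : (fun h : ℝ => (A + h • B).det) = fun h => A.det * (1 + h • (A' * B)).det := by
    funext h
    have e : A + h • B = A * (1 + h • (A' * B)) := by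
      rw [mul_add, mul_one, mul_smul_comm, ← mul_assoc, hA, one_mul]
    rw [e]
    exact LinearMap.det_comp _ _
  rw [h]
  exact (hasDerivAt_det_one_add_smul (A' * B)).const_mul _

/-- A Lie algebra `S` with an invariant inner product that acts on `V` by skew maps, together with
the moment map `V × V → S`. -/
structure OrthogonalAction (S V : Type*) [NormedAddCommGroup S] [InnerProductSpace ℝ S]
    [NormedAddCommGroup V] [InnerProductSpace ℝ V] where
  act : S →L[ℝ] V →L[ℝ] V
  br : S →L[ℝ] S →L[ℝ] S
  moment : V →L[ℝ] V →L[ℝ] S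
  inner_act : ∀ ξ u v, ⟪act ξ u, v⟫ = -⟪u, act ξ v⟫
  inner_br : ∀ A B C, ⟪br A B, C⟫ = -⟪B, br A C⟫
  br_swap : ∀ A B, br A B = -br B A
  act_br : ∀ A B v, act (br A B) v = act A (act B v) - act B (act A v)
  inner_moment : ∀ u v ξ, ⟪moment u v, ξ⟫ = ⟪u, act ξ v⟫

namespace OrthogonalAction

variable {S V : Type*} [NormedAddCommGroup S] [InnerProductSpace ℝ S]
    [NormedAddCommGroup V] [InnerProductSpace ℝ V] (d : OrthogonalAction S V)

theorem moment_swap (u v : V) : d.moment u v = -d.moment v u := by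
  refine ext_inner_right ℝ fun ξ => ?_
  rw [inner_neg_left, d.inner_moment, d.inner_moment, real_inner_comm, d.inner_act]

/-- This is the infinitesimal equivariance of the moment map. Pairing with ξ reduces it to the
invariance of the inner products and to `act_br`. -/
theorem br_moment (Ω : S) (u v : V) :
    d.br Ω (d.moment u v) = d.moment (d.act Ω u) v + d.moment u (d.act Ω v) := by
  refine ext_inner_right ℝ fun ξ => ?_
  rw [inner_add_left, d.inner_br, d.inner_moment, d.inner_moment, d.inner_moment, d.act_br,
    inner_sub_right, d.inner_act]
  ring

theorem inner_act_self (ξ : S) (v : V) : ⟪v, d.act ξ v⟫ = 0 := by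
  have := d.inner_act ξ v v
  rw [real_inner_comm] at this
  linarith

theorem inner_br_self (A B : S) : ⟪A, d.br A B⟫ = 0 := by
  have h := d.inner_br A A B
  have h2 : d.br A A = 0 := by
    have h3 : (2 : ℝ) • d.br A A = 0 := by
      rw [two_smul]
      nth_rw 1 [d.br_swap A A]
      exact neg_add_cancel _
    simpa using h3
  rw [h2, inner_zero_left] at h
  linarith

/-- The map `ξ ↦ (ξ γ) ∧ γ`. -/
def contact (γ : V) : S →L[ℝ] S := d.moment.flip γ ∘L d.act.flip γ

@[simp]
theorem contact_apply (γ : V) (ξ : S) : d.contact γ ξ = d.moment (d.act ξ γ) γ := rfl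

theorem inner_contact (γ : V) (ξ η : S) : ⟪d.contact γ ξ, η⟫ = ⟪d.act ξ γ, d.act η γ⟫ := by
  rw [contact_apply, d.inner_moment]

end OrthogonalAction

/-- An inertia operator together with a rotationally symmetric coupling `κ`. -/
structure ContactSystem (S V : Type*) [NormedAddCommGroup S] [InnerProductSpace ℝ S]
    [NormedAddCommGroup V] [InnerProductSpace ℝ V] extends OrthogonalAction S V where
  inertia : S →L[ℝ] S
  coupling : V → ℝ
  inner_inertia : ∀ A B, ⟪inertia A, B⟫ = ⟪A, inertia B⟫
  inertia_pos : ∀ A, A ≠ 0 → 0 < ⟪inertia A, A⟫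
  contDiff_coupling : ContDiff ℝ 1 coupling
  coupling_nonneg : ∀ γ, 0 ≤ coupling γ
  fderiv_coupling : ∀ γ, ∃ k : ℝ, ∀ δ, fderiv ℝ coupling γ δ = k * ⟪γ, δ⟫

namespace ContactSystem

variable {S V : Type*} [NormedAddCommGroup S] [InnerProductSpace ℝ S]
    [NormedAddCommGroup V] [InnerProductSpace ℝ V] (d : ContactSystem S V)

/-- The map from velocity to momentum. -/
def op (γ : V) : S →L[ℝ] S := d.inertia + d.coupling γ • d.contact γ

theorem op_apply (γ : V) (ξ : S) :
    d.op γ ξ = d.inertia ξ + d.coupling γ • d.moment (d.act ξ γ) γ := rfl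

theorem inner_op (γ : V) (A B : S) : ⟪d.op γ A, B⟫ = ⟪A, d.op γ B⟫ := by
  simp only [op, _root_.add_apply, _root_.smul_apply, inner_add_left,
    inner_add_right, inner_smul_left, inner_smul_right, d.inner_inertia, d.inner_contact]
  rw [real_inner_comm (d.contact γ B) A, d.inner_contact, real_inner_comm (d.act A γ)]
  rfl

theorem inner_op_pos (γ : V) {A : S} (hA : A ≠ 0) : 0 < ⟪d.op γ A, A⟫ := by
  simp only [op, _root_.add_apply, _root_.smul_apply, inner_add_left,
    inner_smul_left, d.inner_contact]
  have h1 := d.inertia_pos A hA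
  have h2 : 0 ≤ d.coupling γ * ⟪d.act A γ, d.act A γ⟫ :=
    mul_nonneg (d.coupling_nonneg γ) real_inner_self_nonneg
  exact add_pos_of_pos_of_nonneg h1 h2

theorem op_injective (γ : V) : Function.Injective (d.op γ) := by
  rw [injective_iff_map_eq_zero]
  intro A hA
  by_contra h
  have := d.inner_op_pos γ h
  rw [hA, inner_zero_left] at this
  exact lt_irrefl _ this

theorem contDiff_op : ContDiff ℝ 1 d.op :=
  contDiff_const.add (d.contDiff_coupling.smul
    (d.moment.flip.contDiff.clm_comp d.act.flip.contDiff))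

variable [FiniteDimensional ℝ S]

theorem isUnit_op (γ : V) : IsUnit (d.op γ) := by
  have h : Function.Bijective (d.op γ) := ⟨d.op_injective γ,
    LinearMap.surjective_of_injective (f := (d.op γ : S →ₗ[ℝ] S)) (d.op_injective γ)⟩
  exact ContinuousLinearMap.isUnit_iff_bijective.2 h

theorem det_op_pos (γ : V) : 0 < (d.op γ).det := by
  have hT : (d.op γ : S →ₗ[ℝ] S).IsSymmetric := d.inner_op γ
  have h : (d.op γ).det = _ := hT.det_eq_prod_eigenvalues rfl
  rw [h]
  refine Finset.prod_pos fun i _ => ?_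
  have h1 := hT.apply_eigenvectorBasis rfl i
  have h2 := d.inner_op_pos γ ((hT.eigenvectorBasis rfl).orthonormal.ne_zero i)
  rw [ContinuousLinearMap.coe_coe] at h1
  rw [h1, inner_smul_left, real_inner_self_eq_norm_sq,
    (hT.eigenvectorBasis rfl).orthonormal.1 i] at h2
  simpa using h2

/-- The map from momentum to velocity. -/
def inv (γ : V) : S →L[ℝ] S := Ring.inverse (d.op γ)

theorem op_mul_inv (γ : V) : d.op γ * d.inv γ = 1 := Ring.mul_inverse_cancel _ (d.isUnit_op γ)

theorem inv_mul_op (γ : V) : d.inv γ * d.op γ = 1 := Ring.inverse_mul_cancel _ (d.isUnit_op γ)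

theorem op_inv (γ : V) (A : S) : d.op γ (d.inv γ A) = A :=
  DFunLike.congr_fun (d.op_mul_inv γ) A

theorem inv_op (γ : V) (A : S) : d.inv γ (d.op γ A) = A :=
  DFunLike.congr_fun (d.inv_mul_op γ) A

theorem inner_inv (γ : V) (A B : S) : ⟪d.inv γ A, B⟫ = ⟪A, d.inv γ B⟫ := by
  conv_lhs => rw [← d.op_inv γ B, ← d.inner_op, d.op_inv]

theorem contDiff_inv : ContDiff ℝ 1 d.inv := by
  have := FiniteDimensional.complete ℝ S
  refine contDiff_iff_contDiffAt.2 fun γ => ?_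
  obtain ⟨u, hu⟩ := d.isUnit_op γ
  have h := contDiffAt_ringInverse ℝ (n := 1) u
  rw [hu] at h
  exact h.comp γ d.contDiff_op.contDiffAt

end ContactSystem

end Abstract

end

end Chaplygin
namespace Chaplygin

noncomputable section

/-! ### The divergence of the weighted field -/

section Divergence

open Set Filter Topology
open scoped RealInnerProductSpace

namespace ContactSystem

variable {S V : Type*} [NormedAddCommGroup S] [InnerProductSpace ℝ S]
    [NormedAddCommGroup V] [InnerProductSpace ℝ V] (d : ContactSystem S V)

theorem fderiv_op_apply (γ δ : V) (ξ : S) : fderiv ℝ d.op γ δ ξ =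
    d.coupling γ • (d.moment (d.act ξ γ) δ + d.moment (d.act ξ δ) γ) +
      fderiv ℝ d.coupling γ δ • d.moment (d.act ξ γ) γ := by
  have h1 : HasFDerivAt (fun γ => d.op γ ξ) ((fderiv ℝ d.op γ).flip ξ) γ := by
    have h := (d.contDiff_op.differentiable one_ne_zero γ).hasFDerivAt.clm_apply
      (hasFDerivAt_const ξ γ)
    convert! h using 1
    ext
    simp
  have h2 : HasFDerivAt (fun γ => d.inertia ξ + d.coupling γ • d.moment (d.act ξ γ) γ) _ γ :=
    ((d.contDiff_coupling.differentiable one_ne_zero γ).hasFDerivAt.smul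
      ((d.moment.hasFDerivAt.comp γ (d.act ξ).hasFDerivAt).clm_apply
        (hasFDerivAt_id γ))).const_add (d.inertia ξ)
  have h3 := DFunLike.congr_fun (h1.unique h2) δ
  simpa using h3

theorem fderiv_coupling_act (γ : V) (ξ : S) : fderiv ℝ d.coupling γ (d.act ξ γ) = 0 := by
  obtain ⟨k, hk⟩ := d.fderiv_coupling γ
  rw [hk, d.inner_act_self, mul_zero]

/-- The operator `op` is transported by the rotations. -/
theorem fderiv_op_rotation (γ : V) (Ω ξ : S) : fderiv ℝ d.op γ (-d.act Ω γ) ξ =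
    d.coupling γ • (d.contact γ (d.br Ω ξ) - d.br Ω (d.contact γ ξ)) := by
  rw [fderiv_op_apply, map_neg (fderiv ℝ d.coupling γ), d.fderiv_coupling_act, neg_zero, zero_smul,
    add_zero, d.contact_apply, d.contact_apply, d.br_moment, d.act_br]
  simp only [map_neg, map_sub, _root_.sub_apply, _root_.neg_apply]
  congr 1
  abel

/-- The equations of motion. -/
def field (x : S × V) : S × V := (d.br x.1 (d.inv x.2 x.1), -d.act (d.inv x.2 x.1) x.2)

theorem hasFDerivAt_field_fst (M : S) (γ : V) :
    HasFDerivAt (fun M => (d.field (M, γ)).1)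
      (d.br.flip (d.inv γ M) + d.br M ∘L d.inv γ) M := by
  have h := (d.br.hasFDerivAt (x := M)).clm_apply ((d.inv γ).hasFDerivAt (x := M))
  rw [add_comm]
  convert! h using 1

variable [FiniteDimensional ℝ S]

/-- The trace of `L⁻¹ ad_Ω Π`, where `Π` is the contact part of `L`. -/
def twist (γ : V) (Ω : S) : ℝ :=
  d.coupling γ * LinearMap.trace ℝ S
    ((d.inv γ ∘L d.br Ω ∘L d.contact γ : S →L[ℝ] S) : S →ₗ[ℝ] S)

/-- The derivative of L along the rotation is κ(Π ad_Ω - ad_Ω Π). Passing to adjoints turns tr(L⁻¹ Π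
ad_Ω) into -tr(ad_Ω Π L⁻¹), so both terms contribute -`twist`. With `fderiv_det_op` this is the rate
of change of log det L. -/
theorem trace_inv_mul_fderiv_op (γ : V) (Ω : S) :
    LinearMap.trace ℝ S ((d.inv γ * fderiv ℝ d.op γ (-d.act Ω γ) : S →L[ℝ] S) : S →ₗ[ℝ] S) =
      -2 * d.twist γ Ω := by
  have h1 : ((d.inv γ * fderiv ℝ d.op γ (-d.act Ω γ) : S →L[ℝ] S) : S →ₗ[ℝ] S) =
      d.coupling γ • (((d.inv γ : S →ₗ[ℝ] S) ∘ₗ (d.contact γ : S →ₗ[ℝ] S) ∘ₗ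
        (d.br Ω : S →ₗ[ℝ] S)) - ((d.inv γ ∘L d.br Ω ∘L d.contact γ : S →L[ℝ] S) : S →ₗ[ℝ] S)) := by
    refine LinearMap.ext fun ξ => ?_
    change d.inv γ (fderiv ℝ d.op γ (-d.act Ω γ) ξ) = _
    rw [fderiv_op_rotation, map_smul, map_sub]
    rfl
  have h2 : LinearMap.trace ℝ S ((d.inv γ : S →ₗ[ℝ] S) ∘ₗ (d.contact γ : S →ₗ[ℝ] S) ∘ₗ
        (d.br Ω : S →ₗ[ℝ] S)) = LinearMap.trace ℝ S (-((d.br Ω : S →ₗ[ℝ] S) ∘ₗ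
        (d.contact γ : S →ₗ[ℝ] S) ∘ₗ (d.inv γ : S →ₗ[ℝ] S))) := by
    refine trace_eq_of_inner fun x y => ?_
    simp only [LinearMap.comp_apply, ContinuousLinearMap.coe_coe, LinearMap.neg_apply]
    rw [d.inner_inv, d.inner_contact, real_inner_comm, ← d.inner_contact, real_inner_comm,
      d.inner_br, inner_neg_right]
  have h3 := LinearMap.trace_comp_comm' ((d.br Ω : S →ₗ[ℝ] S) ∘ₗ (d.contact γ : S →ₗ[ℝ] S))
    (d.inv γ : S →ₗ[ℝ] S)
  rw [LinearMap.comp_assoc] at h3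
  have h4 : LinearMap.trace ℝ S ((d.inv γ ∘L d.br Ω ∘L d.contact γ : S →L[ℝ] S) : S →ₗ[ℝ] S) =
    LinearMap.trace ℝ S ((d.br Ω : S →ₗ[ℝ] S) ∘ₗ
        (d.contact γ : S →ₗ[ℝ] S) ∘ₗ (d.inv γ : S →ₗ[ℝ] S)) := h3
  rw [h1, map_smul, map_sub, h2, map_neg, twist, h4, smul_eq_mul]
  ring

/-- Obtained by differentiating L_γ(L_γ⁻¹ M) = M in γ. -/
theorem hasFDerivAt_inv_apply (γ : V) (M : S) : HasFDerivAt (fun γ => d.inv γ M)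
    (-(d.inv γ ∘L (fderiv ℝ d.op γ).flip (d.inv γ M))) γ := by
  have hd := (d.contDiff_inv.differentiable one_ne_zero γ).hasFDerivAt
  have h0 : HasFDerivAt (fun γ => d.inv γ M) ((fderiv ℝ d.inv γ).flip M) γ := by
    convert! hd.clm_apply (hasFDerivAt_const M γ) using 1
    ext
    simp
  have h1 := (d.contDiff_op.differentiable one_ne_zero γ).hasFDerivAt.clm_apply h0
  have h2 : (fun γ => d.op γ (d.inv γ M)) = fun _ => M := funext fun γ => d.op_inv γ M
  rw [h2] at h1
  have h3 := h1.unique (hasFDerivAt_const M γ)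
  convert! h0 using 1
  ext δ
  have h4 := DFunLike.congr_fun h3 δ
  simp only [_root_.add_apply, ContinuousLinearMap.comp_apply, _root_.zero_apply] at h4
  have h5 := congrArg (d.inv γ) h4
  rw [map_add, d.inv_op, map_zero] at h5
  exact (eq_neg_of_add_eq_zero_left h5).symm

theorem hasFDerivAt_det_op (γ : V) : HasFDerivAt (fun γ => (d.op γ).det)
    (fderiv ℝ (fun γ => (d.op γ).det) γ) γ :=
  (((contDiff_det (m := 1)).comp d.contDiff_op).differentiable one_ne_zero γ).hasFDerivAt

theorem fderiv_det_op (γ δ : V) : fderiv ℝ (fun γ => (d.op γ).det) γ δ =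
    (d.op γ).det *
      LinearMap.trace ℝ S ((d.inv γ * fderiv ℝ d.op γ δ : S →L[ℝ] S) : S →ₗ[ℝ] S) := by
  have hD := ((contDiff_det (E := S) (m := 1)).differentiable one_ne_zero (d.op γ)).hasFDerivAt
  have hL := (d.contDiff_op.differentiable one_ne_zero γ).hasFDerivAt
  have h1 : fderiv ℝ (fun γ => (d.op γ).det) γ = _ := (hD.comp γ hL).fderiv
  rw [h1, ContinuousLinearMap.comp_apply]
  have e2 : HasDerivAt (fun s : ℝ => d.op γ + s • fderiv ℝ d.op γ δ) (fderiv ℝ d.op γ δ) 0 := by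
    simpa using ((hasDerivAt_id (0 : ℝ)).smul_const (fderiv ℝ d.op γ δ)).const_add (d.op γ)
  have hD' := hD
  rw [← add_zero (d.op γ), ← zero_smul ℝ (fderiv ℝ d.op γ δ)] at hD'
  have h3 := (hD'.comp_hasDerivAt (0 : ℝ) e2).unique
    (hasDerivAt_det_add_smul (d.op_mul_inv γ) (fderiv ℝ d.op γ δ))
  rwa [zero_smul, add_zero] at h3

/-- The exponent -1/2 balances the factor -2 in `trace_inv_mul_fderiv_op` against the factor -1 in
`trace_field_snd`. -/
def density (x : S × V) : ℝ := (d.op x.2).det ^ (-(1 / 2) : ℝ)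

theorem contDiff_field : ContDiff ℝ 1 d.field := by
  have h1 : ContDiff ℝ 1 fun x : S × V => d.inv x.2 x.1 :=
    (d.contDiff_inv.comp contDiff_snd).clm_apply contDiff_fst
  exact ((d.br.contDiff.comp contDiff_fst).clm_apply h1).prodMk
    ((d.act.contDiff.comp h1).clm_apply contDiff_snd).neg

theorem contDiff_density : ContDiff ℝ 1 d.density := by
  refine contDiff_iff_contDiffAt.2 fun x => ?_
  refine ContDiffAt.rpow_const_of_ne ?_ (d.det_op_pos x.2).ne'
  exact (contDiff_det.comp (d.contDiff_op.comp contDiff_snd)).contDiffAt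

theorem density_nonneg (x : S × V) : 0 ≤ d.density x := (Real.rpow_pos_of_pos (d.det_op_pos _) _).le

theorem fderiv_density_field (x : S × V) :
    fderiv ℝ d.density x (d.field x) = d.density x * d.twist x.2 (d.inv x.2 x.1) := by
  have h1 := ((d.hasFDerivAt_det_op x.2).comp x hasFDerivAt_snd).rpow_const (p := (-(1 / 2) : ℝ))
    (Or.inl (d.det_op_pos x.2).ne')
  have h2 : fderiv ℝ d.density x = _ := h1.fderiv
  have h3 := d.det_op_pos x.2
  rw [h2, _root_.smul_apply, ContinuousLinearMap.comp_apply, ContinuousLinearMap.coe_snd',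
    fderiv_det_op, field, trace_inv_mul_fderiv_op, density, Function.comp_apply,
    Real.rpow_sub_one h3.ne', smul_eq_mul]
  field_simp

theorem hasFDerivAt_field_snd (M : S) (γ : V) :
    HasFDerivAt (fun γ => (d.field (M, γ)).2)
      (d.act.flip γ ∘L d.inv γ ∘L (fderiv ℝ d.op γ).flip (d.inv γ M) - d.act (d.inv γ M)) γ := by
  have h := ((d.act.hasFDerivAt.comp γ (d.hasFDerivAt_inv_apply γ M)).clm_apply
    (hasFDerivAt_id γ)).neg
  convert! h using 1
  ext δ
  simp
  abel

/-- The first summand M' ↦ [M', Ω] is skew; the second is the skew map ad_M after the symmetric map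
L⁻¹. -/
theorem trace_field_fst (M : S) (γ : V) : LinearMap.trace ℝ S
    ((d.br.flip (d.inv γ M) + d.br M ∘L d.inv γ : S →L[ℝ] S) : S →ₗ[ℝ] S) = 0 := by
  rw [ContinuousLinearMap.toLinearMap_add, map_add, trace_skew, zero_add]
  · exact trace_skew_comp_symm (A := (d.br M : S →ₗ[ℝ] S)) (B := (d.inv γ : S →ₗ[ℝ] S))
      (d.inner_br M) (d.inner_inv γ)
  · intro x y
    simp only [ContinuousLinearMap.coe_coe, ContinuousLinearMap.flip_apply]
    rw [d.br_swap x, d.br_swap y, inner_neg_left, d.inner_br, inner_neg_right]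

variable [FiniteDimensional ℝ V]

/-- By `br_moment`, (Ωγ) ∧ δ = (Ωδ) ∧ γ - [Ω, δ ∧ γ], which splits the map into four parts. The
parts with (Ωδ) ∧ γ and with Ωδ have trace zero, as symmetric after skew and as skew. The derivative
of κ gives a rank one map, of trace zero because the gradient of κ is radial. The bracket gives
-`twist` after cyclic permutation. -/
theorem trace_field_snd (γ : V) (Ω : S) : LinearMap.trace ℝ V
    ((d.act.flip γ ∘L d.inv γ ∘L (fderiv ℝ d.op γ).flip Ω - d.act Ω : V →L[ℝ] V) :
      V →ₗ[ℝ] V) = -d.twist γ Ω := by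
  set T : S →ₗ[ℝ] V := (d.act.flip γ : S →L[ℝ] V).toLinearMap with hT
  set W : V →ₗ[ℝ] S := (d.moment.flip γ : V →L[ℝ] S).toLinearMap with hW
  set R : S →ₗ[ℝ] S := (d.inv γ : S →L[ℝ] S).toLinearMap with hR
  set A : S →ₗ[ℝ] S := (d.br Ω : S →L[ℝ] S).toLinearMap with hA
  set a : V →ₗ[ℝ] V := (d.act Ω : V →L[ℝ] V).toLinearMap with ha
  have h1 : ((d.act.flip γ ∘L d.inv γ ∘L (fderiv ℝ d.op γ).flip Ω - d.act Ω : V →L[ℝ] V) :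
      V →ₗ[ℝ] V) = (2 * d.coupling γ) • ((T ∘ₗ R ∘ₗ W) ∘ₗ a) -
        d.coupling γ • (T ∘ₗ (R ∘ₗ A ∘ₗ W)) +
        ((fderiv ℝ d.coupling γ : V →L[ℝ] ℝ) : V →ₗ[ℝ] ℝ).smulRight
          (d.act (d.inv γ (d.moment (d.act Ω γ) γ)) γ) - a := by
    refine LinearMap.ext fun δ => ?_
    change d.act (d.inv γ (fderiv ℝ d.op γ δ Ω)) γ - d.act Ω δ =
      (2 * d.coupling γ) • d.act (d.inv γ (d.moment (d.act Ω δ) γ)) γ -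
        d.coupling γ • d.act (d.inv γ (d.br Ω (d.moment δ γ))) γ +
        (fderiv ℝ d.coupling γ δ) • d.act (d.inv γ (d.moment (d.act Ω γ) γ)) γ - d.act Ω δ
    rw [fderiv_op_apply, d.br_moment, d.moment_swap (d.act Ω γ) δ]
    simp only [map_add, map_smul, map_neg, _root_.add_apply, _root_.smul_apply, _root_.neg_apply]
    module
  have h2 : LinearMap.trace ℝ V ((T ∘ₗ R ∘ₗ W) ∘ₗ a) = 0 := by
    rw [LinearMap.trace_comp_comm']
    refine trace_skew_comp_symm (d.inner_act Ω) fun u v => ?_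
    change ⟪d.act (d.inv γ (d.moment u γ)) γ, v⟫ = ⟪u, d.act (d.inv γ (d.moment v γ)) γ⟫
    rw [real_inner_comm, ← d.inner_moment, ← d.inner_moment, real_inner_comm, d.inner_inv]
  have h3 : LinearMap.trace ℝ V (T ∘ₗ (R ∘ₗ A ∘ₗ W)) = LinearMap.trace ℝ S
      ((d.inv γ ∘L d.br Ω ∘L d.contact γ : S →L[ℝ] S) : S →ₗ[ℝ] S) :=
    LinearMap.trace_comp_comm' (R ∘ₗ A ∘ₗ W) T
  have h4 : LinearMap.trace ℝ V a = 0 := trace_skew (d.inner_act Ω)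
  rw [h1, map_sub, map_add, map_sub, map_smul, map_smul, h2, h3, h4, LinearMap.trace_smulRight,
    ContinuousLinearMap.coe_coe, d.fderiv_coupling_act, twist, smul_zero, smul_eq_mul]
  ring

theorem divergence_field (x : S × V) : fderiv ℝ d.density x (d.field x) +
    d.density x * LinearMap.trace ℝ (S × V) (fderiv ℝ d.field x : S × V →ₗ[ℝ] S × V) = 0 := by
  have hX := (d.contDiff_field.differentiable one_ne_zero x).hasFDerivAt
  have h1 : LinearMap.fst ℝ S V ∘ₗ (fderiv ℝ d.field x : S × V →ₗ[ℝ] S × V) ∘ₗ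
      LinearMap.inl ℝ S V =
      ((d.br.flip (d.inv x.2 x.1) + d.br x.1 ∘L d.inv x.2 : S →L[ℝ] S) : S →ₗ[ℝ] S) := by
    have h := (hasFDerivAt_fst (p := d.field x)).comp x.1 (HasFDerivAt.comp x.1 (f := fun M => (M, x.2))
      hX (hasFDerivAt_prodMk_left x.1 x.2))
    have h' := h.unique (d.hasFDerivAt_field_fst x.1 x.2)
    rw [← h']
    rfl
  have h2 : LinearMap.snd ℝ S V ∘ₗ (fderiv ℝ d.field x : S × V →ₗ[ℝ] S × V) ∘ₗ
      LinearMap.inr ℝ S V =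
      ((d.act.flip x.2 ∘L d.inv x.2 ∘L (fderiv ℝ d.op x.2).flip (d.inv x.2 x.1) -
        d.act (d.inv x.2 x.1) : V →L[ℝ] V) : V →ₗ[ℝ] V) := by
    have h := (hasFDerivAt_snd (p := d.field x)).comp x.2 (HasFDerivAt.comp x.2 (f := fun γ => (x.1, γ))
      hX (hasFDerivAt_prodMk_right x.1 x.2))
    have h' := h.unique (d.hasFDerivAt_field_snd x.1 x.2)
    rw [← h']
    rfl
  rw [trace_prod, h1, h2, d.trace_field_fst, d.trace_field_snd, d.fderiv_density_field]
  ring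

theorem isProperFirstIntegral_field :
    IsProperFirstIntegral d.field fun x => ⟪x.1, x.1⟫ + ⟪x.2, x.2⟫ where
  contDiff_field := d.contDiff_field
  contDiff := (contDiff_fst.inner ℝ contDiff_fst).add (contDiff_snd.inner ℝ contDiff_snd)
  isCompact R := by
    have : ProperSpace S := FiniteDimensional.proper ℝ S
    have : ProperSpace V := FiniteDimensional.proper ℝ V
    -- If t² ≤ |R| then t ≤ |R| + 1, a radius that needs no square root.
    refine (isCompact_closedBall (0 : S × V) (|R| + 1)).of_isClosed_subset
      (isClosed_le (by fun_prop) continuous_const) fun x hx => ?_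
    have hx' : ⟪x.1, x.1⟫ + ⟪x.2, x.2⟫ ≤ R := hx
    rw [real_inner_self_eq_norm_sq, real_inner_self_eq_norm_sq] at hx'
    have := le_abs_self R
    rw [mem_closedBall_zero_iff, Prod.norm_def]
    exact max_le (by nlinarith [sq_nonneg ‖x.2‖, norm_nonneg x.1])
      (by nlinarith [sq_nonneg ‖x.1‖, norm_nonneg x.2])
  fderiv_apply x := by
    have h : HasFDerivAt (fun x : S × V => ⟪x.1, x.1⟫ + ⟪x.2, x.2⟫) _ x :=
      ((hasFDerivAt_fst (p := x)).inner ℝ (hasFDerivAt_fst (p := x))).add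
        ((hasFDerivAt_snd (p := x)).inner ℝ (hasFDerivAt_snd (p := x)))
    rw [h.fderiv]
    simp [field, d.inner_br_self, d.inner_act_self, real_inner_comm]

end ContactSystem

end Divergence

end

end Chaplygin
namespace Chaplygin

noncomputable section

/-! ### Radial projection of an annulus to the sphere -/

section Annulus

open Set Filter Topology
open scoped ENNReal

variable {V : Type*} [NormedAddCommGroup V]

/-- Half-open, so that the radii form `Iio 2 \ Iio 1` in terms of intervals of explicit mass. It
starts at radius 1, from where on the coupling is exactly b/|γ|². -/
def annulus (V : Type*) [NormedAddCommGroup V] : Set V := {v | 1 ≤ ‖v‖ ∧ ‖v‖ < 2}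

theorem ne_zero_of_mem_annulus {v : V} (hv : v ∈ annulus V) : v ≠ 0 := by
  rintro rfl
  have := hv.1
  rw [norm_zero] at this
  linarith

theorem measurableSet_annulus [MeasurableSpace V] [BorelSpace V] : MeasurableSet (annulus V) :=
  (measurableSet_le measurable_const measurable_norm).inter
    (measurableSet_lt measurable_norm measurable_const)

variable [NormedSpace ℝ V]

/-- The radial projection to the unit sphere, with a given value at the origin. -/
def radial (e : sphere (0 : V) 1) (v : V) : sphere (0 : V) 1 :=
  open scoped Classical in
  if h : v = 0 then e else ⟨‖v‖⁻¹ • v, by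
    rw [mem_sphere_zero_iff_norm, norm_smul, norm_inv, norm_norm,
      inv_mul_cancel₀ (norm_ne_zero_iff.2 h)]⟩

theorem coe_radial (e : sphere (0 : V) 1) {v : V} (h : v ≠ 0) :
    (radial e v : V) = ‖v‖⁻¹ • v := by
  rw [radial, dif_neg h]

theorem radial_smul (e p : sphere (0 : V) 1) {r : ℝ} (hr : 0 < r) :
    radial e (r • (p : V)) = p := by
  have hp : ‖(p : V)‖ = 1 := mem_sphere_zero_iff_norm.1 p.2
  have h : r • (p : V) ≠ 0 := by
    rw [← norm_ne_zero_iff, norm_smul, hp, mul_one, Real.norm_eq_abs, abs_of_pos hr]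
    exact hr.ne'
  apply Subtype.ext
  rw [coe_radial e h, norm_smul, hp, mul_one, Real.norm_eq_abs, abs_of_pos hr, smul_smul,
    inv_mul_cancel₀ hr.ne', one_smul]

theorem norm_smul_radial (e : sphere (0 : V) 1) {v : V} (h : v ≠ 0) :
    ‖v‖ • (radial e v : V) = v := by
  rw [coe_radial e h, smul_smul, mul_inv_cancel₀ (norm_ne_zero_iff.2 h), one_smul]

variable [MeasurableSpace V] [BorelSpace V]

variable [FiniteDimensional ℝ V]

theorem measurable_radial (e : sphere (0 : V) 1) : Measurable (radial e) := by
  have h : (fun v => (radial e v : V)) = fun v => open scoped Classical in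
      if v ∈ ({0} : Set V) then (e : V) else ‖v‖⁻¹ • v := by
    funext v
    by_cases hv : v = 0
    · simp [radial, hv]
    · rw [coe_radial e hv, if_neg (by simpa using hv)]
  have h2 : Measurable fun v => (radial e v : V) := by
    rw [h]
    exact Measurable.ite (measurableSet_singleton 0) measurable_const
      (measurable_norm.inv.smul measurable_id)
  exact h2.subtype_mk

/-- In polar coordinates μ is the product of the sphere measure and a radial measure, and the
annulus is a product set. The constant is the radial mass of [1, 2). -/
theorem exists_map_radial (μ : Measure V) [μ.IsAddHaarMeasure] (e : sphere (0 : V) 1) :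
    ∃ C : ℝ≥0∞, C ≠ 0 ∧ C ≠ ∞ ∧
      (μ.restrict (annulus V)).map (radial e) = C • μ.toSphere := by
  set k := Module.finrank ℝ V - 1
  let one : Ioi (0 : ℝ) := ⟨1, mem_Ioi.2 one_pos⟩
  let two : Ioi (0 : ℝ) := ⟨2, mem_Ioi.2 two_pos⟩
  have hfin : ∀ x, Measure.volumeIoiPow k (Iio x) ≠ ∞ := fun x => by
    rw [Measure.volumeIoiPow_apply_Iio]
    exact ENNReal.ofReal_ne_top
  refine ⟨Measure.volumeIoiPow k (Iio two \ Iio one), ?_, ?_, ?_⟩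
  · intro h
    have h1 : Measure.volumeIoiPow k (Iio two) ≤ Measure.volumeIoiPow k (Iio one) := by
      have := measure_mono (μ := Measure.volumeIoiPow k)
        (show Iio two ⊆ (Iio two \ Iio one) ∪ Iio one from fun x hx => by
          by_cases hx' : x ∈ Iio one
          · exact Or.inr hx'
          · exact Or.inl ⟨hx, hx'⟩)
      refine this.trans ((measure_union_le _ _).trans ?_)
      rw [h, zero_add]
    rw [Measure.volumeIoiPow_apply_Iio, Measure.volumeIoiPow_apply_Iio,
      ENNReal.ofReal_le_ofReal_iff (by positivity)] at h1
    have h2 : (1 : ℝ) < 2 ^ (k + 1) := one_lt_pow₀ one_lt_two (by omega)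
    have h3 : (0 : ℝ) < k + 1 := by positivity
    rw [div_le_div_iff_of_pos_right h3] at h1
    simp only [one, two, one_pow] at h1
    linarith
  · exact ne_top_of_le_ne_top (hfin two) (measure_mono sdiff_subset)
  · ext B hB
    have hmp := μ.measurePreserving_homeomorphUnitSphereProd
    have hI : MeasurableSet (Iio two \ Iio one) := measurableSet_Iio.diff measurableSet_Iio
    have h1 := hmp.measure_preimage (hB.prod hI).nullMeasurableSet
    rw [Measure.prod_prod, comap_subtype_coe_apply (measurableSet_singleton _).compl] at h1
    rw [Measure.map_apply (measurable_radial e) hB,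
      Measure.restrict_apply (measurable_radial e hB), Measure.smul_apply, smul_eq_mul, mul_comm,
      ← h1]
    congr 1
    ext v
    constructor
    · rintro ⟨hv, hv'⟩
      have h0 := ne_zero_of_mem_annulus hv'
      refine ⟨⟨v, h0⟩, ⟨?_, ?_, ?_⟩, rfl⟩
      · have e1 : (homeomorphUnitSphereProd V ⟨v, h0⟩).1 = radial e v := by
          apply Subtype.ext
          rw [coe_radial e h0]
          simp
        rw [e1]
        exact hv
      · rw [mem_Iio, ← Subtype.coe_lt_coe, homeomorphUnitSphereProd_apply_snd_coe]
        exact hv'.2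
      · rw [mem_Iio, ← Subtype.coe_lt_coe, homeomorphUnitSphereProd_apply_snd_coe, not_lt]
        exact hv'.1
    · rintro ⟨⟨v, h0⟩, ⟨h1, h2, h3⟩, rfl⟩
      have e1 : (homeomorphUnitSphereProd V ⟨v, h0⟩).1 = radial e v := by
        apply Subtype.ext
        rw [coe_radial e h0]
        simp
      rw [mem_Iio, ← Subtype.coe_lt_coe, homeomorphUnitSphereProd_apply_snd_coe] at h2 h3
      rw [e1] at h1
      exact ⟨h1, not_lt.1 h3, h2⟩

end Annulus

end

end Chaplygin
namespace Chaplygin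

noncomputable section

/-! ### Restriction of the flow to the sphere -/

section SphereFlow

open Set Filter Topology
open scoped RealInnerProductSpace ENNReal

theorem map_withDensity_comp {α β : Type*} [MeasurableSpace α] [MeasurableSpace β] {μ : Measure α}
    {g : α → β} (hg : Measurable g) {f : β → ℝ≥0∞} (hf : Measurable f) :
    (μ.withDensity (f ∘ g)).map g = (μ.map g).withDensity f := by
  ext s hs
  rw [Measure.map_apply hg hs, withDensity_apply _ (hg hs), withDensity_apply _ hs,
    setLIntegral_map hs hf hg]
  rfl

theorem hasDerivAt_fst {F G : Type*} [NormedAddCommGroup F] [NormedSpace ℝ F]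
    [NormedAddCommGroup G] [NormedSpace ℝ G] {c : ℝ → F × G} {c' : F × G} {t : ℝ}
    (h : HasDerivAt c c' t) : HasDerivAt (fun s => (c s).1) c'.1 t :=
  (hasFDerivAt_fst (𝕜 := ℝ) (p := c t)).comp_hasDerivAt t h

theorem hasDerivAt_snd {F G : Type*} [NormedAddCommGroup F] [NormedSpace ℝ F]
    [NormedAddCommGroup G] [NormedSpace ℝ G] {c : ℝ → F × G} {c' : F × G} {t : ℝ}
    (h : HasDerivAt c c' t) : HasDerivAt (fun s => (c s).2) c'.2 t :=
  (hasFDerivAt_snd (𝕜 := ℝ) (p := c t)).comp_hasDerivAt t h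

theorem measurePreserving_of_smul {α : Type*} [MeasurableSpace α] {m : Measure α} {f : α → α}
    {C : ℝ≥0∞} (h0 : C ≠ 0) (hC : C ≠ ∞) (h : MeasurePreserving f (C • m) (C • m)) :
    MeasurePreserving f m m := by
  refine ⟨h.measurable, ?_⟩
  have h1 := h.map_eq
  ext s hs
  have h2 := DFunLike.congr_fun h1 s
  rw [Measure.map_smul, Measure.smul_apply, Measure.smul_apply, smul_eq_mul, smul_eq_mul] at h2
  exact (ENNReal.mul_right_inj h0 hC).1 h2

/-- The push-forward of a preserved measure under a map that intertwines two dynamics. -/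
theorem measurePreserving_map_of_semiconj {α β : Type*} [MeasurableSpace α] [MeasurableSpace β]
    {m : Measure α} {f : α → α} {F : β → β} {π : α → β} (hf : MeasurePreserving f m m)
    (hF : Measurable F) (hπ : Measurable π) (h : ∀ᵐ x ∂m, F (π x) = π (f x)) :
    MeasurePreserving F (m.map π) (m.map π) := by
  refine ⟨hF, ?_⟩
  rw [Measure.map_map hF hπ, Measure.map_congr (f := F ∘ π) (g := π ∘ f) h,
    ← Measure.map_map hπ hf.measurable, hf.map_eq]

namespace ContactSystem

variable {S V : Type*} [NormedAddCommGroup S] [InnerProductSpace ℝ S]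
    [NormedAddCommGroup V] [InnerProductSpace ℝ V] (d : ContactSystem S V)

/-- The inclusion `S × 𝕊 → S × V`. -/
def incl (p : S × sphere (0 : V) 1) : S × V := (p.1, p.2)

/-- On the annulus the coupling is homogeneous of degree `-2`, so that the operator depends only on
the direction. -/
def IsHomogeneous : Prop :=
  ∀ (p : sphere (0 : V) 1) (r : ℝ), 1 ≤ r → r < 2 →
    d.coupling (r • (p : V)) * r ^ 2 = d.coupling p

theorem op_smul (hd : d.IsHomogeneous) (p : sphere (0 : V) 1) {r : ℝ} (h1 : 1 ≤ r) (h2 : r < 2) :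
    d.op (r • (p : V)) = d.op p := by
  ext ξ
  rw [op_apply, op_apply, ← hd p r h1 h2]
  simp only [map_smul, _root_.smul_apply, smul_smul]
  congr 2
  ring

theorem inv_smul (hd : d.IsHomogeneous) (p : sphere (0 : V) 1) {r : ℝ} (h1 : 1 ≤ r) (h2 : r < 2) :
    d.inv (r • (p : V)) = d.inv p := by
  rw [inv, inv, d.op_smul hd p h1 h2]

theorem norm_snd_of_hasDerivAt {c : ℝ → S × V} (hc : ∀ t, HasDerivAt c (d.field (c t)) t) (t : ℝ) :
    ‖(c t).2‖ = ‖(c 0).2‖ := by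
  have hd : ∀ s, HasDerivAt (fun s => ⟪(c s).2, (c s).2⟫) 0 s := fun s => by
    have h1 : HasDerivAt (fun s => (c s).2) (d.field (c s)).2 s :=
      hasDerivAt_snd (hc s)
    have h2 := h1.inner ℝ h1
    convert! h2 using 1
    simp [field, d.inner_act_self, real_inner_comm]
  have h := is_const_of_deriv_eq_zero (fun s => (hd s).differentiableAt) (fun s => (hd s).deriv) t 0
  simp only [real_inner_self_eq_norm_sq] at h
  exact (pow_left_inj₀ (norm_nonneg _) (norm_nonneg _) two_ne_zero).1 h

theorem norm_snd_flow {φ : ℝ → S × V → S × V} (hφ : IsGlobalFlow d.field φ) (t : ℝ) (x : S × V) :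
    ‖(φ t x).2‖ = ‖x.2‖ := by
  have h := d.norm_snd_of_hasDerivAt (hφ.hasDerivAt x) t
  rwa [hφ.zero] at h

section Construction

variable {φ : ℝ → S × V → S × V} (hφ : IsGlobalFlow d.field φ)

/-- The flow on `S × 𝕊` obtained by restriction. -/
def sphereFlow (t : ℝ) (p : S × sphere (0 : V) 1) : S × sphere (0 : V) 1 :=
  ((φ t (incl p)).1, ⟨(φ t (incl p)).2, by
    rw [mem_sphere_zero_iff_norm, d.norm_snd_flow hφ]
    exact mem_sphere_zero_iff_norm.1 p.2.2⟩)

theorem incl_sphereFlow (t : ℝ) (p : S × sphere (0 : V) 1) :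
    incl (d.sphereFlow hφ t p) = φ t (incl p) := rfl

variable [FiniteDimensional ℝ S] [FiniteDimensional ℝ V]

/-- On these radii L depends only on the direction, so scaling γ by r carries solutions to
solutions; uniqueness does the rest. -/
theorem flow_smul (hd : d.IsHomogeneous) {φ : ℝ → S × V → S × V}
    (hφ : IsGlobalFlow d.field φ) (p : S × sphere (0 : V) 1) {r : ℝ} (h1 : 1 ≤ r)
    (h2 : r < 2) (t : ℝ) :
    φ t (p.1, r • (p.2 : V)) = ((φ t (incl p)).1, r • (φ t (incl p)).2) := by
  have := FiniteDimensional.complete ℝ S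
  have := FiniteDimensional.complete ℝ V
  have hc : ∀ t, HasDerivAt (fun t => ((φ t (incl p)).1, r • (φ t (incl p)).2))
      (d.field ((φ t (incl p)).1, r • (φ t (incl p)).2)) t := by
    intro t
    have h3 := hφ.hasDerivAt (incl p) t
    have e1 : HasDerivAt (fun t => (φ t (incl p)).1) (d.field (φ t (incl p))).1 t :=
      hasDerivAt_fst h3
    have e2 : HasDerivAt (fun t => (φ t (incl p)).2) (d.field (φ t (incl p))).2 t :=
      hasDerivAt_snd h3
    have e3 := e1.prodMk (e2.const_smul r)
    convert! e3 using 1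
    have e4 := d.inv_smul hd (d.sphereFlow hφ t p).2 h1 h2
    have e5 : ((d.sphereFlow hφ t p).2 : V) = (φ t (incl p)).2 := rfl
    rw [e5] at e4
    simp only [field, e4, map_smul, smul_neg]
  have h := d.isProperFirstIntegral_field.eq_flow hφ hc t
  rw [h, hφ.zero]
  rfl

variable [MeasurableSpace S] [BorelSpace S] [MeasurableSpace V] [BorelSpace V]

theorem measurable_sphereFlow (t : ℝ) : Measurable (d.sphereFlow hφ t) := by
  have := FiniteDimensional.complete ℝ S
  have := FiniteDimensional.complete ℝ V
  have h1 : Measurable (φ t) := (d.isProperFirstIntegral_field.continuous_flow hφ t).measurable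
  have h2 : Measurable (incl (S := S) (V := V)) :=
    measurable_fst.prodMk (measurable_subtype_coe.comp measurable_snd)
  have h3 := h1.comp h2
  exact (measurable_fst.comp h3).prodMk (measurable_snd.comp h3).subtype_mk

/-- The flow preserves |γ|, hence the annulus, and the radial projection intertwines it with the
flow on the sphere. So the push-forward of the weighted measure on the annulus, a multiple of the
wanted measure, is preserved. -/
theorem measurePreserving_sphereFlow (hd : d.IsHomogeneous) [Nontrivial V] (ν : Measure S)
    [ν.IsAddHaarMeasure] (μ : Measure V) [μ.IsAddHaarMeasure] (t : ℝ) :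
    MeasurePreserving (d.sphereFlow hφ t)
      ((ν.prod μ.toSphere).withDensity fun p => ENNReal.ofReal (d.density (incl p)))
      ((ν.prod μ.toSphere).withDensity fun p => ENNReal.ofReal (d.density (incl p))) := by
  obtain ⟨e0, he0⟩ := (NormedSpace.sphere_nonempty (x := (0 : V)) (r := 1)).2 zero_le_one
  set e : sphere (0 : V) 1 := ⟨e0, he0⟩
  obtain ⟨C, hC0, hC, hmap⟩ := exists_map_radial μ e
  set A : Set (S × V) := univ ×ˢ annulus V with hA
  have hAm : MeasurableSet A := MeasurableSet.univ.prod measurableSet_annulus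
  set π : S × V → S × sphere (0 : V) 1 := Prod.map id (radial e) with hπ
  have hπm : Measurable π := measurable_id.prodMap (measurable_radial e)
  have hρm : Measurable fun x : S × V => ENNReal.ofReal (d.density x) :=
    d.contDiff_density.continuous.measurable.ennreal_ofReal
  have hincl : Measurable (incl (S := S) (V := V)) :=
    measurable_fst.prodMk (measurable_subtype_coe.comp measurable_snd)
  set m := ((ν.prod μ).withDensity fun x => ENNReal.ofReal (d.density x)).restrict A with hm
  have hflow : MeasurePreserving (φ t) m m := by
    have h1 := (d.isProperFirstIntegral_field.measurePreserving_flow (ν.prod μ) hφ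
      d.contDiff_density d.density_nonneg d.divergence_field t).restrict_preimage hAm
    have h2 : φ t ⁻¹' A = A := by
      ext x
      simp only [hA, annulus, mem_preimage, mem_prod, mem_univ, true_and, mem_ofPred_eq,
        d.norm_snd_flow hφ]
    rwa [h2] at h1
  have hpolar : ∀ x ∈ A, x = (x.1, ‖x.2‖ • ((π x).2 : V)) := fun x hx =>
    Prod.ext rfl (norm_smul_radial e (ne_zero_of_mem_annulus hx.2)).symm
  have hsemi : ∀ x ∈ A, d.sphereFlow hφ t (π x) = π (φ t x) := by
    intro x hx
    have h1 := d.flow_smul hd hφ (π x) hx.2.1 hx.2.2 t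
    have h2 : φ t x = φ t ((π x).1, ‖x.2‖ • ((π x).2 : V)) := congrArg _ (hpolar x hx)
    rw [h2, h1]
    refine Prod.ext rfl ?_
    exact (radial_smul e (d.sphereFlow hφ t (π x)).2 (zero_lt_one.trans_le hx.2.1)).symm
  have hmπ : m.map π = C • (ν.prod μ.toSphere).withDensity
      fun p => ENNReal.ofReal (d.density (incl p)) := by
    -- On the annulus the density depends only on the direction, so it is pulled back from the
    -- sphere along π.
    have h1 : m = ((ν.prod μ).restrict A).withDensity
        ((fun p => ENNReal.ofReal (d.density (incl p))) ∘ π) := by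
      rw [hm, restrict_withDensity hAm]
      refine withDensity_congr_ae ?_
      filter_upwards [ae_restrict_mem hAm] with x hx
      have h2 : d.op x.2 = d.op (π x).2 := by
        rw [← d.op_smul hd (π x).2 hx.2.1 hx.2.2]
        exact congrArg (fun x : S × V => d.op x.2) (hpolar x hx)
      simp only [density, h2, Function.comp_apply, incl]
    rw [h1, map_withDensity_comp (f := fun p => ENNReal.ofReal (d.density (incl p))) hπm
      (hρm.comp hincl), hA, ← Measure.prod_restrict,
      Measure.restrict_univ, hπ, ← Measure.map_prod_map _ _ measurable_id (measurable_radial e),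
      Measure.map_id, hmap, Measure.prod_smul_right, withDensity_smul_measure]
  have hfin := measurePreserving_map_of_semiconj hflow (d.measurable_sphereFlow hφ t) hπm
    (by
      have : ∀ᵐ x ∂m, x ∈ A := ae_restrict_mem hAm
      filter_upwards [this] with x hx using hsemi x hx)
  rw [hmπ] at hfin
  exact measurePreserving_of_smul hC0 hC hfin

end Construction

end ContactSystem

end SphereFlow

end

end Chaplygin
namespace Chaplygin

noncomputable section

/-! ### The inner product on so(n) and the concrete contact system -/

section InnerProduct

open Set Filter Topology

variable {n : ℕ}

theorem transpose_coe (A : so (Fin n) ℝ) : A.1ᵀ = -A.1 := (mem_so (Fin n) ℝ A.1).1 A.2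

theorem isTopologicalAddGroup_so : IsTopologicalAddGroup (so (Fin n) ℝ) :=
  { continuous_add := continuous_induced_rng.2
      ((continuous_subtype_val.comp continuous_fst).add (continuous_subtype_val.comp continuous_snd))
    continuous_neg := continuous_induced_rng.2 continuous_subtype_val.neg }

theorem continuousConstSMul_so : ContinuousConstSMul ℝ (so (Fin n) ℝ) :=
  ⟨fun c => continuous_induced_rng.2 (continuous_subtype_val.const_smul c)⟩

attribute [local instance] isTopologicalAddGroup_so continuousConstSMul_so

/-- The inner product `½ tr (Aᵗ B)` on `so(n)`. -/
@[reducible] def soCore (n : ℕ) : InnerProductSpace.Core ℝ (so (Fin n) ℝ) where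
  inner A B := (1 / 2) * trace (A.1ᵀ * B.1)
  conj_inner_symm A B := by
    change (1 / 2) * trace (B.1ᵀ * A.1) = _
    rw [← trace_transpose, transpose_mul, transpose_transpose]
  re_inner_nonneg A := by
    change 0 ≤ (1 / 2) * trace (A.1ᵀ * A.1)
    have : trace (A.1ᵀ * A.1) = ∑ i, ∑ j, A.1 j i ^ 2 := by
      simp [trace, Matrix.mul_apply, pow_two]
    rw [this]
    positivity
  add_left A B C := by
    change (1 / 2) * trace ((A.1 + B.1)ᵀ * C.1) = _
    rw [transpose_add, add_mul, trace_add, mul_add]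
  smul_left A B r := by
    change (1 / 2) * trace ((r • A.1)ᵀ * B.1) = r * _
    rw [transpose_smul, smul_mul_assoc, trace_smul, smul_eq_mul]
    ring
  definite A h := by
    have h1 : (1 / 2) * trace (A.1ᵀ * A.1) = 0 := h
    have h2 : trace (A.1ᵀ * A.1) = ∑ i, ∑ j, A.1 j i ^ 2 := by
      simp [trace, Matrix.mul_apply, pow_two]
    have h3 : ∑ i, ∑ j, A.1 j i ^ 2 = 0 := by linarith
    apply Subtype.ext
    ext i j
    rw [Finset.sum_eq_zero_iff_of_nonneg fun _ _ => by positivity] at h3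
    have h4 := h3 j (Finset.mem_univ _)
    rw [Finset.sum_eq_zero_iff_of_nonneg fun _ _ => by positivity] at h4
    exact pow_eq_zero_iff two_ne_zero |>.1 (h4 i (Finset.mem_univ _))

theorem continuousAt_soCore : ContinuousAt (fun A : so (Fin n) ℝ => (soCore n).inner A A) 0 := by
  have : Continuous (fun A : so (Fin n) ℝ => (1 / 2) * trace (A.1ᵀ * A.1)) := by fun_prop
  exact this.continuousAt

theorem isVonNBounded_soCore :
    Bornology.IsVonNBounded ℝ {A : so (Fin n) ℝ | RCLike.re ((soCore n).inner A A) < 1} := by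
  refine Bornology.isVonNBounded_of_smul_tendsto_zero (ε := fun k : ℕ => 1 / ((k : ℝ) + 1))
    (l := atTop) (Eventually.of_forall fun k => by positivity) fun x hx => ?_
  refine tendsto_subtype_rng.2 (tendsto_pi_nhds.2 fun i => tendsto_pi_nhds.2 fun j => ?_)
  have hb : ∀ k, |(x k).1 i j| ≤ 2 := by
    intro k
    have h1 : (1 / 2) * trace ((x k).1ᵀ * (x k).1) < 1 := hx k
    have h2 : trace ((x k).1ᵀ * (x k).1) = ∑ j, ∑ i, (x k).1 i j ^ 2 := by
      simp [trace, Matrix.mul_apply, pow_two]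
    have h3 : (x k).1 i j ^ 2 ≤ ∑ j, ∑ i, (x k).1 i j ^ 2 :=
      (Finset.single_le_sum (f := fun i => (x k).1 i j ^ 2) (fun _ _ => by positivity)
        (Finset.mem_univ i)).trans
        (Finset.single_le_sum (f := fun j => ∑ i, (x k).1 i j ^ 2) (fun _ _ => by positivity)
        (Finset.mem_univ j))
    refine abs_le_of_sq_le_sq ?_ zero_le_two
    linarith
  have h4 : Tendsto (fun k : ℕ => 1 / ((k : ℝ) + 1) * 2) atTop (𝓝 0) := by
    simpa using tendsto_one_div_add_atTop_nhds_zero_nat.mul_const (2 : ℝ)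
  refine squeeze_zero_norm (fun k => ?_) h4
  change |1 / ((k : ℝ) + 1) * (x k).1 i j| ≤ _
  rw [abs_mul, abs_of_pos (by positivity : (0 : ℝ) < 1 / ((k : ℝ) + 1))]
  exact mul_le_mul_of_nonneg_left (hb k) (by positivity)

-- The norm is built on the existing subspace topology, so that the Borel sets and the Haar measure
-- ν keep their meaning.
@[reducible] def soNormedAddCommGroup (n : ℕ) : NormedAddCommGroup (so (Fin n) ℝ) :=
  (soCore n).toNormedAddCommGroupOfTopology continuousAt_soCore isVonNBounded_soCore

attribute [local instance] soNormedAddCommGroup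

@[reducible] def soInnerProductSpace (n : ℕ) : InnerProductSpace ℝ (so (Fin n) ℝ) :=
  InnerProductSpace.ofCoreOfTopology (soCore n) continuousAt_soCore isVonNBounded_soCore

attribute [local instance] soInnerProductSpace

theorem inner_so (A B : so (Fin n) ℝ) : inner ℝ A B = (1 / 2) * trace (A.1ᵀ * B.1) := rfl


/-- The commutator on `so(n)`. -/
def commutator (A B : so (Fin n) ℝ) : so (Fin n) ℝ :=
  ⟨A.1 * B.1 - B.1 * A.1, by
    rw [mem_so, transpose_sub, transpose_mul, transpose_mul, transpose_coe, transpose_coe]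
    simp⟩

def actBilin (n : ℕ) : so (Fin n) ℝ →ₗ[ℝ] EuclideanSpace ℝ (Fin n) →ₗ[ℝ]
    EuclideanSpace ℝ (Fin n) :=
  LinearMap.mk₂ ℝ (fun ξ v => WithLp.toLp 2 (ξ.1 *ᵥ v.ofLp))
    (fun A B v => by
      apply WithLp.ofLp_injective
      exact add_mulVec A.1 B.1 v.ofLp)
    (fun c A v => by
      apply WithLp.ofLp_injective
      exact smul_mulVec c A.1 v.ofLp)
    (fun A u v => by
      apply WithLp.ofLp_injective
      exact mulVec_add A.1 u.ofLp v.ofLp)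
    (fun c A v => by
      apply WithLp.ofLp_injective
      exact mulVec_smul A.1 c v.ofLp)

def commutatorBilin (n : ℕ) : so (Fin n) ℝ →ₗ[ℝ] so (Fin n) ℝ →ₗ[ℝ] so (Fin n) ℝ :=
  LinearMap.mk₂ ℝ commutator
    (fun A B C => Subtype.ext (by
      change (A.1 + B.1) * C.1 - C.1 * (A.1 + B.1) =
        (A.1 * C.1 - C.1 * A.1) + (B.1 * C.1 - C.1 * B.1)
      noncomm_ring))
    (fun c A B => Subtype.ext (by
      change (c • A.1) * B.1 - B.1 * (c • A.1) = c • (A.1 * B.1 - B.1 * A.1)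
      rw [smul_mul_assoc, mul_smul_comm, smul_sub]))
    (fun A B C => Subtype.ext (by
      change A.1 * (B.1 + C.1) - (B.1 + C.1) * A.1 =
        (A.1 * B.1 - B.1 * A.1) + (A.1 * C.1 - C.1 * A.1)
      noncomm_ring))
    (fun c A B => Subtype.ext (by
      change A.1 * (c • B.1) - (c • B.1) * A.1 = c • (A.1 * B.1 - B.1 * A.1)
      rw [smul_mul_assoc, mul_smul_comm, smul_sub]))

def wedgeBilin (n : ℕ) : EuclideanSpace ℝ (Fin n) →ₗ[ℝ] EuclideanSpace ℝ (Fin n) →ₗ[ℝ]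
    so (Fin n) ℝ :=
  LinearMap.mk₂ ℝ (fun u v => wedge u.ofLp v.ofLp)
    (fun u v w => Subtype.ext (by
      change vecMulVec (u.ofLp + v.ofLp) w.ofLp - vecMulVec w.ofLp (u.ofLp + v.ofLp) =
        (vecMulVec u.ofLp w.ofLp - vecMulVec w.ofLp u.ofLp) +
          (vecMulVec v.ofLp w.ofLp - vecMulVec w.ofLp v.ofLp)
      rw [add_vecMulVec, vecMulVec_add]
      abel))
    (fun c u w => Subtype.ext (by
      change vecMulVec (c • u.ofLp) w.ofLp - vecMulVec w.ofLp (c • u.ofLp) =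
        c • (vecMulVec u.ofLp w.ofLp - vecMulVec w.ofLp u.ofLp)
      rw [smul_vecMulVec, vecMulVec_smul, smul_sub]))
    (fun w u v => Subtype.ext (by
      change vecMulVec w.ofLp (u.ofLp + v.ofLp) - vecMulVec (u.ofLp + v.ofLp) w.ofLp =
        (vecMulVec w.ofLp u.ofLp - vecMulVec u.ofLp w.ofLp) +
          (vecMulVec w.ofLp v.ofLp - vecMulVec v.ofLp w.ofLp)
      rw [add_vecMulVec, vecMulVec_add]
      abel))
    (fun c w u => Subtype.ext (by
      change vecMulVec w.ofLp (c • u.ofLp) - vecMulVec (c • u.ofLp) w.ofLp =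
        c • (vecMulVec w.ofLp u.ofLp - vecMulVec u.ofLp w.ofLp)
      rw [smul_vecMulVec, vecMulVec_smul, smul_sub]))

theorem inner_euclidean (u v : EuclideanSpace ℝ (Fin n)) :
    inner ℝ u v = u.ofLp ⬝ᵥ v.ofLp := by
  rw [EuclideanSpace.inner_eq_star_dotProduct, star_trivial, dotProduct_comm]

theorem so_mulVec_dotProduct (ξ : so (Fin n) ℝ) (u v : Fin n → ℝ) :
    (ξ.1 *ᵥ u) ⬝ᵥ v = -(u ⬝ᵥ (ξ.1 *ᵥ v)) := by
  rw [dotProduct_comm, dotProduct_mulVec, ← mulVec_transpose, transpose_coe, neg_mulVec,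
    neg_dotProduct, dotProduct_comm]

theorem inner_wedge (u v : Fin n → ℝ) (ξ : so (Fin n) ℝ) :
    inner ℝ (wedge u v) ξ = u ⬝ᵥ (ξ.1 *ᵥ v) := by
  have h1 := so_mulVec_dotProduct ξ u v
  rw [inner_so, wedge, transpose_sub, transpose_vecMulVec, transpose_vecMulVec, sub_mul,
    trace_sub, trace_mul_comm, trace_mul_comm (vecMulVec u v), mul_vecMulVec, mul_vecMulVec,
    trace_vecMulVec, trace_vecMulVec, h1, dotProduct_comm (ξ.1 *ᵥ v)]
  ring

/-- The action of `so(n)` on `ℝⁿ`. -/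
def soAction (n : ℕ) : OrthogonalAction (so (Fin n) ℝ) (EuclideanSpace ℝ (Fin n)) where
  act := (actBilin n).toContinuousBilinearMap
  br := (commutatorBilin n).toContinuousBilinearMap
  moment := (wedgeBilin n).toContinuousBilinearMap
  inner_act ξ u v := by
    rw [inner_euclidean, inner_euclidean]
    exact so_mulVec_dotProduct ξ u.ofLp v.ofLp
  inner_br A B C := by
    change (1 / 2) * trace ((A.1 * B.1 - B.1 * A.1)ᵀ * C.1) =
      -((1 / 2) * trace (B.1ᵀ * (A.1 * C.1 - C.1 * A.1)))
    rw [transpose_sub, transpose_mul, transpose_mul, transpose_coe, transpose_coe]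
    have h := trace_mul_comm (A.1) (B.1 * C.1)
    simp only [neg_mul, mul_neg, neg_neg, sub_mul, mul_sub, trace_sub, trace_neg, ← mul_assoc]
      at h ⊢
    rw [h]
    ring
  br_swap A B := Subtype.ext (neg_sub _ _).symm
  act_br A B v := by
    apply WithLp.ofLp_injective
    change (A.1 * B.1 - B.1 * A.1) *ᵥ v.ofLp = A.1 *ᵥ (B.1 *ᵥ v.ofLp) - B.1 *ᵥ (A.1 *ᵥ v.ofLp)
    rw [sub_mulVec, mulVec_mulVec, mulVec_mulVec]
  inner_moment u v ξ := by
    rw [inner_euclidean]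
    exact inner_wedge u.ofLp v.ofLp ξ

/-- The inequality also holds for n = 0, where the axis is the empty vector, so `chaplyginSystem`
needs no condition on n. -/
theorem axis_dotProduct_axis_le (n : ℕ) : axis n ⬝ᵥ axis n ≤ 1 := by
  have h : axis n ⬝ᵥ axis n = ∑ i ∈ Finset.univ.filter fun i : Fin n => (i : ℕ) + 1 = n, (1 : ℝ) := by
    simp only [dotProduct, axis, Finset.sum_filter]
    exact Finset.sum_congr rfl fun i _ => by split_ifs <;> simp
  rw [h, Finset.sum_const, nsmul_eq_mul, mul_one, Nat.cast_le_one, Finset.card_le_one]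
  intro i hi j hj
  have h1 := (Finset.mem_filter.1 hi).2
  have h2 := (Finset.mem_filter.1 hj).2
  exact Fin.ext (by omega)

/-- For skew A one has E Eᵗ A = -E (AE)ᵗ, so the rank one part of 𝕁 acts like a contact term with E
in place of γ. -/
theorem inertia_massTensor (a : ℝ) (A : so (Fin n) ℝ) :
    inertia (massTensor n a) (massTensor_isSymm n a) A =
      (2 : ℝ) • A + a • wedge (A.1 *ᵥ axis n) (axis n) := by
  apply Subtype.ext
  change massTensor n a * A.1 + A.1 * massTensor n a =
    (2 : ℝ) • A.1 + a • (vecMulVec (A.1 *ᵥ axis n) (axis n) - vecMulVec (axis n) (A.1 *ᵥ axis n))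
  have h : vecMulVec (axis n) (axis n) * A.1 = -vecMulVec (axis n) (A.1 *ᵥ axis n) := by
    rw [vecMulVec_mul, ← mulVec_transpose, transpose_coe, neg_mulVec, vecMulVec_neg]
  rw [massTensor, add_mul, mul_add, smul_mul_assoc, mul_smul_comm, h, mul_vecMulVec, one_mul,
    mul_one, two_smul, smul_sub, smul_neg]
  abel

/-- Expand |(AE) ∧ E - A|² ≥ 0. The bound makes 2|A|² + a|AE|² positive for A ≠ 0 and a ≥ -1. -/
theorem dotProduct_mulVec_axis_le (A : so (Fin n) ℝ) :
    (A.1 *ᵥ axis n) ⬝ᵥ (A.1 *ᵥ axis n) ≤ inner ℝ A A := by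
  set u := A.1 *ᵥ axis n with hu
  have h1 : inner ℝ (wedge u (axis n)) A = u ⬝ᵥ u := inner_wedge _ _ _
  have h2 : inner ℝ (wedge u (axis n)) (wedge u (axis n)) ≤ u ⬝ᵥ u := by
    rw [inner_wedge, wedge, sub_mulVec, vecMulVec_mulVec, vecMulVec_mulVec, dotProduct_sub,
      op_smul_eq_smul, op_smul_eq_smul, dotProduct_smul, dotProduct_smul,
      smul_eq_mul, smul_eq_mul]
    have h3 := axis_dotProduct_axis_le n
    have h4 : 0 ≤ u ⬝ᵥ u := Finset.sum_nonneg fun i _ => mul_self_nonneg _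
    nlinarith [mul_self_nonneg (u ⬝ᵥ axis n)]
  have h5 : 0 ≤ inner ℝ (wedge u (axis n) - A) (wedge u (axis n) - A) := real_inner_self_nonneg
  rw [inner_sub_left, inner_sub_right, inner_sub_right, h1,
    real_inner_comm (wedge u (axis n)) A, h1] at h5
  linarith

/-- A smooth function that equals `b / ‖γ‖²` away from the origin. -/
def coupling (n : ℕ) (b : ℝ) (γ : EuclideanSpace ℝ (Fin n)) : ℝ :=
  b * (Real.smoothTransition (4 * ‖γ‖ ^ 2 - 1) / ‖γ‖ ^ 2)

theorem coupling_of_one_le {b : ℝ} {γ : EuclideanSpace ℝ (Fin n)} (h : 1 ≤ ‖γ‖) :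
    coupling n b γ = b / ‖γ‖ ^ 2 := by
  rw [coupling, Real.smoothTransition.one_of_one_le (by nlinarith), mul_one_div]

/-- The numerator vanishes for s ≤ 1/4, so the quotient is identically 0 near the singular point. -/
theorem contDiff_smoothTransition_div :
    ContDiff ℝ 1 fun s : ℝ => Real.smoothTransition (4 * s - 1) / s := by
  refine contDiff_iff_contDiffAt.2 fun s => ?_
  by_cases hs : s = 0
  · subst hs
    refine contDiffAt_const (c := (0 : ℝ)).congr_of_eventuallyEq ?_
    filter_upwards [Iio_mem_nhds (show (0 : ℝ) < 1 / 4 by norm_num)] with s hs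
    have : s < 1 / 4 := hs
    rw [Real.smoothTransition.zero_of_nonpos (by linarith), zero_div]
  · exact (Real.smoothTransition.contDiff.comp (by fun_prop)).contDiffAt.div contDiffAt_id hs

theorem contDiff_coupling (b : ℝ) : ContDiff ℝ 1 (coupling n b) :=
  contDiff_const.mul (contDiff_smoothTransition_div.comp (contDiff_norm_sq ℝ))

theorem exists_fderiv_coupling (b : ℝ) (γ : EuclideanSpace ℝ (Fin n)) :
    ∃ k : ℝ, ∀ δ, fderiv ℝ (coupling n b) γ δ = k * inner ℝ γ δ := by
  set h := fun s : ℝ => Real.smoothTransition (4 * s - 1) / s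
  have h1 : HasDerivAt h (deriv h (‖γ‖ ^ 2)) (‖γ‖ ^ 2) :=
    (contDiff_smoothTransition_div.differentiable one_ne_zero _).hasDerivAt
  have h2 := (h1.comp_hasFDerivAt γ (hasStrictFDerivAt_norm_sq γ).hasFDerivAt).const_mul b
  have h3 : fderiv ℝ (coupling n b) γ = _ := h2.fderiv
  refine ⟨b * deriv h (‖γ‖ ^ 2) * 2, fun δ => ?_⟩
  rw [h3]
  simp
  ring

/-- The axisymmetric Chaplygin sphere, extended to all vectors `γ`. -/
def chaplyginSystem (n : ℕ) {a b : ℝ} (ha : -1 ≤ a) (hb : 0 ≤ b) :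
    ContactSystem (so (Fin n) ℝ) (EuclideanSpace ℝ (Fin n)) where
  toOrthogonalAction := soAction n
  inertia := (inertia (massTensor n a) (massTensor_isSymm n a)).toContinuousLinearMap
  coupling := coupling n b
  inner_inertia A B := by
    rw [LinearMap.coe_toContinuousLinearMap', inertia_massTensor, inertia_massTensor,
      inner_add_left, inner_add_right, inner_smul_left, inner_smul_right, inner_smul_left,
      inner_smul_right, inner_wedge, real_inner_comm (wedge (B.1 *ᵥ axis n) (axis n)) A, inner_wedge,
      dotProduct_comm]
    rfl
  inertia_pos A hA := by
    have h1 : 0 < inner ℝ A A := real_inner_self_pos.2 hA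
    have h2 := dotProduct_mulVec_axis_le A
    have h3 : 0 ≤ (A.1 *ᵥ axis n) ⬝ᵥ (A.1 *ᵥ axis n) := Finset.sum_nonneg fun i _ => mul_self_nonneg _
    rw [LinearMap.coe_toContinuousLinearMap', inertia_massTensor, inner_add_left, inner_smul_left,
      inner_smul_left, inner_wedge]
    change 0 < 2 * inner ℝ A A + a * ((A.1 *ᵥ axis n) ⬝ᵥ (A.1 *ᵥ axis n))
    nlinarith
  contDiff_coupling := contDiff_coupling b
  coupling_nonneg γ := mul_nonneg hb
    (div_nonneg (Real.smoothTransition.nonneg _) (sq_nonneg _))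
  fderiv_coupling := exists_fderiv_coupling b

theorem isHomogeneous_chaplyginSystem {a b : ℝ} (ha : -1 ≤ a) (hb : 0 ≤ b) :
    (chaplyginSystem n ha hb).IsHomogeneous := by
  intro p r h1 _
  have hp : ‖(p : EuclideanSpace ℝ (Fin n))‖ = 1 := mem_sphere_zero_iff_norm.1 p.2
  have hr : ‖r • (p : EuclideanSpace ℝ (Fin n))‖ = r := by
    rw [norm_smul, hp, mul_one, Real.norm_eq_abs, abs_of_nonneg (by linarith)]
  have hr0 : r ≠ 0 := by linarith
  change coupling n b _ * r ^ 2 = coupling n b _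
  rw [coupling_of_one_le hp.ge, coupling_of_one_le (h1.trans hr.ge), hr, hp]
  field_simp

theorem op_chaplyginSystem {a b : ℝ} (ha : -1 ≤ a) (hb : 0 ≤ b) (γ : UnitSphere n) :
    ((chaplyginSystem n ha hb).op γ : so (Fin n) ℝ →ₗ[ℝ] so (Fin n) ℝ) = L a b γ := by
  have hp : ‖(γ : EuclideanSpace ℝ (Fin n))‖ = 1 := mem_sphere_zero_iff_norm.1 γ.2
  have hc : (chaplyginSystem n ha hb).coupling γ = b := by
    change coupling n b _ = b
    rw [coupling_of_one_le hp.ge, hp]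
    simp
  refine LinearMap.ext fun ξ => ?_
  rw [ContinuousLinearMap.coe_coe, ContactSystem.op_apply, hc]
  rfl

end InnerProduct

end

end Chaplygin
namespace Chaplygin

noncomputable section

/-! ### The determinant of L_γ -/

section Determinant

open Set Filter Topology Polynomial

attribute [local instance] isTopologicalAddGroup_so continuousConstSMul_so soNormedAddCommGroup
  soInnerProductSpace

variable {n : ℕ}

/-- Equal multisets of values mean fibres of equal size, and bijections of the fibres assemble to a
permutation. It serves to list eigenvalues in a prescribed order. -/
theorem exists_perm_of_map_eq {ι α : Type*} [Fintype ι] [DecidableEq α] {f g : ι → α}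
    (h : Finset.univ.val.map f = Finset.univ.val.map g) : ∃ σ : Equiv.Perm ι, f ∘ σ = g := by
  have hcard : ∀ y, Nonempty ({i // g i = y} ≃ {i // f i = y}) := by
    intro y
    have h1 := congrArg (Multiset.count y) h
    rw [Multiset.count_map, Multiset.count_map] at h1
    classical
    refine Fintype.card_eq.1 ?_
    rw [Fintype.card_subtype, Fintype.card_subtype]
    simp only [eq_comm (b := y)]
    exact h1.symm
  have e : ∀ y, {i // g i = y} ≃ {i // f i = y} := fun y => (hcard y).some
  refine ⟨Equiv.ofFiberEquiv e, funext fun i => ?_⟩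
  exact Equiv.ofFiberEquiv_map e i

/-- The index set of the pairs `i < j`. -/
abbrev Pairs (n : ℕ) : Type := Σ i : Fin n, Finset.Ioi i

variable (v : OrthonormalBasis (Fin n) ℝ (EuclideanSpace ℝ (Fin n)))

def wedgeFamily (p : Pairs n) : so (Fin n) ℝ := wedge (v p.1).ofLp (v p.2).ofLp

theorem dotProduct_orthonormalBasis (i j : Fin n) :
    (v i).ofLp ⬝ᵥ (v j).ofLp = if i = j then 1 else 0 := by
  rw [← inner_euclidean]
  exact orthonormal_iff_ite.1 v.orthonormal i j

theorem orthonormal_wedgeFamily : Orthonormal ℝ (wedgeFamily v) := by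
  rw [orthonormal_iff_ite]
  rintro ⟨i, j, hj⟩ ⟨k, l, hl⟩
  have hj' := Finset.mem_Ioi.1 hj
  have hl' := Finset.mem_Ioi.1 hl
  rw [wedgeFamily, inner_wedge, wedgeFamily, wedge, sub_mulVec, vecMulVec_mulVec, vecMulVec_mulVec,
    dotProduct_sub, op_smul_eq_smul, op_smul_eq_smul, dotProduct_smul, dotProduct_smul]
  simp only [dotProduct_orthonormalBasis, smul_eq_mul]
  have : ((⟨i, j, hj⟩ : Pairs n) = ⟨k, l, hl⟩) ↔ i = k ∧ j = l := by
    constructor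
    · intro h
      cases h
      exact ⟨rfl, rfl⟩
    · rintro ⟨rfl, rfl⟩
      rfl
  simp only [this]
  split_ifs <;> first | omega | simp

theorem so_eq_zero_of_dotProduct (ξ : so (Fin n) ℝ)
    (h : ∀ i j, (v i).ofLp ⬝ᵥ (ξ.1 *ᵥ (v j).ofLp) = 0) : ξ = 0 := by
  have h1 : ∀ j, actBilin n ξ (v j) = 0 := fun j => by
    rw [← v.sum_repr (actBilin n ξ (v j))]
    refine Finset.sum_eq_zero fun i _ => ?_
    rw [v.repr_apply_apply, inner_euclidean]
    exact smul_eq_zero_of_left (h i j) _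
  have h2 : actBilin n ξ = 0 := v.toBasis.ext fun j => by simpa using h1 j
  apply Subtype.ext
  refine Matrix.ext_of_mulVec_single fun i => ?_
  have h3 := congrArg WithLp.ofLp (DFunLike.congr_fun h2 (WithLp.toLp 2 (Pi.single i 1)))
  exact h3.trans (zero_mulVec _).symm

def wedgeBasis : OrthonormalBasis (Pairs n) ℝ (so (Fin n) ℝ) :=
  OrthonormalBasis.mkOfOrthogonalEqBot (orthonormal_wedgeFamily v) (by
    rw [Submodule.eq_bot_iff]
    intro ξ hξ
    have hlt : ∀ i j, i < j → (v i).ofLp ⬝ᵥ (ξ.1 *ᵥ (v j).ofLp) = 0 := fun i j hij => by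
      rw [← inner_wedge]
      exact hξ _ (Submodule.subset_span ⟨⟨i, j, Finset.mem_Ioi.2 hij⟩, rfl⟩)
    refine so_eq_zero_of_dotProduct v ξ fun i j => ?_
    rcases lt_trichotomy i j with h | h | h
    · exact hlt i j h
    · subst h
      have := so_mulVec_dotProduct ξ (v i).ofLp (v i).ofLp
      rw [dotProduct_comm] at this
      linarith
    · have := so_mulVec_dotProduct ξ (v i).ofLp (v j).ofLp
      rw [dotProduct_comm, hlt j i h] at this
      linarith)

theorem wedgeBasis_apply (p : Pairs n) : wedgeBasis v p = wedgeFamily v p := by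
  rw [wedgeBasis, OrthonormalBasis.coe_of_orthogonal_eq_bot_mk]

theorem inertia_wedge {J : Matrix (Fin n) (Fin n) ℝ} (hJ : J.IsSymm) {x y : Fin n → ℝ} {r s : ℝ}
    (hx : J *ᵥ x = r • x) (hy : J *ᵥ y = s • y) :
    inertia J hJ (wedge x y) = (r + s) • wedge x y := by
  apply Subtype.ext
  change J * (vecMulVec x y - vecMulVec y x) + (vecMulVec x y - vecMulVec y x) * J =
    (r + s) • (vecMulVec x y - vecMulVec y x)
  have h1 : x ᵥ* J = r • x := by rw [← mulVec_transpose, hJ.eq, hx]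
  have h2 : y ᵥ* J = s • y := by rw [← mulVec_transpose, hJ.eq, hy]
  rw [mul_sub, sub_mul, mul_vecMulVec, mul_vecMulVec, vecMulVec_mul, vecMulVec_mul, h1, h2, hx, hy,
    smul_vecMulVec, smul_vecMulVec, vecMulVec_smul, vecMulVec_smul]
  module

/-- The wedges of an orthonormal eigenbasis of J form an eigenbasis of the inertia operator, by
`inertia_wedge`. -/
theorem det_inertia {J : Matrix (Fin n) (Fin n) ℝ} (hJ : J.IsSymm) (r : Fin n → ℝ)
    (hv : ∀ i, J *ᵥ (v i).ofLp = r i • (v i).ofLp) :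
    LinearMap.det (inertia J hJ) = ∏ i, ∏ j ∈ Finset.Ioi i, (r i + r j) := by
  classical
  have h1 : LinearMap.toMatrix (wedgeBasis v).toBasis (wedgeBasis v).toBasis (inertia J hJ) =
      diagonal fun p : Pairs n => r p.1 + r p.2 := by
    ext p q
    rw [LinearMap.toMatrix_apply, OrthonormalBasis.coe_toBasis, wedgeBasis_apply, wedgeFamily,
      inertia_wedge hJ (hv _) (hv _), map_smul]
    have : wedge (v q.1).ofLp (v q.2).ofLp = (wedgeBasis v).toBasis q := by
      rw [OrthonormalBasis.coe_toBasis, wedgeBasis_apply, wedgeFamily]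
    rw [this, Module.Basis.repr_self, diagonal_apply]
    by_cases h : p = q
    · subst h; simp
    · simp [h]
  rw [← LinearMap.det_toMatrix (wedgeBasis v).toBasis, h1, det_diagonal, Fintype.prod_sigma]
  exact Finset.prod_congr rfl fun i _ => Finset.prod_coe_sort (Finset.Ioi i) fun j => r i + r j

theorem axis_dotProduct_axis (hn : n ≠ 0) : axis n ⬝ᵥ axis n = 1 := by
  obtain ⟨m, rfl⟩ := Nat.exists_eq_succ_of_ne_zero hn
  rw [dotProduct, Finset.sum_eq_single (Fin.last m)]
  · simp [axis]
  · intro i _ hi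
    have : (i : ℕ) ≠ m := fun h => hi (Fin.ext h)
    simp [axis, this]
  · simp

theorem sphere_dotProduct_self (γ : UnitSphere n) : γ.1.ofLp ⬝ᵥ γ.1.ofLp = 1 := by
  rw [← inner_euclidean, real_inner_self_eq_norm_sq, mem_sphere_zero_iff_norm.1 γ.2, one_pow]

theorem height_sq_le_one (γ : UnitSphere n) : height γ ^ 2 ≤ 1 := by
  have h1 := real_inner_mul_inner_self_le γ.1 (WithLp.toLp 2 (axis n))
  rw [inner_euclidean, inner_euclidean, inner_euclidean, sphere_dotProduct_self, one_mul] at h1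
  rw [pow_two]
  exact h1.trans (axis_dotProduct_axis_le n)

theorem Delta_pos {a b x : ℝ} (ha : -1 ≤ a) (hb : 0 ≤ b) (hx : x ^ 2 ≤ 1) : 0 < Delta a b x := by
  -- In this form the first term is positive and the second nonnegative, since a ≥ -1 and 0 ≤ 1 - x²
  -- ≤ 1.
  have h : Delta a b x = 2 * (2 + a) + b * (2 + a * (1 - x ^ 2)) := by
    rw [Delta]
    ring
  have h1 : 0 ≤ 2 + a * (1 - x ^ 2) := by nlinarith [sq_nonneg x]
  rw [h]
  nlinarith [mul_nonneg hb h1]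

/-- The symmetric matrix `𝕁 + b γ γᵗ`. -/
def contactTensor (a b : ℝ) (γ : UnitSphere n) : Matrix (Fin n) (Fin n) ℝ :=
  massTensor n a + b • vecMulVec γ.1.ofLp γ.1.ofLp

theorem contactTensor_isSymm (a b : ℝ) (γ : UnitSphere n) : (contactTensor a b γ).IsSymm := by
  unfold contactTensor Matrix.IsSymm
  rw [transpose_add, massTensor_isSymm, transpose_smul, transpose_vecMulVec]

/-- For skew A one has γγᵗA = -γ(Aγ)ᵗ, so the contact term is itself the inertia operator of γγᵗ. -/
theorem L_eq_inertia (a b : ℝ) (γ : UnitSphere n) :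
    L a b γ = inertia (contactTensor a b γ) (contactTensor_isSymm a b γ) := by
  refine LinearMap.ext fun A => Subtype.ext ?_
  set g := γ.1.ofLp
  change (massTensor n a * A.1 + A.1 * massTensor n a) +
      b • (vecMulVec (A.1 *ᵥ g) g - vecMulVec g (A.1 *ᵥ g)) =
    (massTensor n a + b • vecMulVec g g) * A.1 + A.1 * (massTensor n a + b • vecMulVec g g)
  have h : vecMulVec g g * A.1 = -vecMulVec g (A.1 *ᵥ g) := by
    rw [vecMulVec_mul, ← mulVec_transpose, transpose_coe, neg_mulVec, vecMulVec_neg]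
  rw [add_mul, mul_add, smul_mul_assoc, mul_smul_comm, h, mul_vecMulVec, smul_sub, smul_neg]
  abel

/-- The rank two part of `contactTensor`. -/
def rankTwo (a b : ℝ) (γ : UnitSphere n) : Matrix (Fin n) (Fin n) ℝ :=
  a • vecMulVec (axis n) (axis n) + b • vecMulVec γ.1.ofLp γ.1.ofLp

theorem contactTensor_eq (a b : ℝ) (γ : UnitSphere n) :
    contactTensor a b γ = 1 + rankTwo a b γ := add_assoc _ _ _

theorem rankTwo_isHermitian (a b : ℝ) (γ : UnitSphere n) : (rankTwo a b γ).IsHermitian := by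
  rw [Matrix.IsHermitian, conjTranspose_eq_transpose_of_trivial]
  simp only [rankTwo, transpose_add, transpose_smul, transpose_vecMulVec]

/-- Factor the matrix as UW through ℝ². Up to the power of X, its characteristic polynomial is that
of the 2 × 2 matrix WU, whose entries are scalar products of E and γ. -/
theorem charpoly_rankTwo {m : ℕ} (a b : ℝ) (γ : UnitSphere (m + 2)) :
    (rankTwo a b γ).charpoly =
      X ^ m * (X ^ 2 - C (a + b) * X + C (a * b * (1 - height γ ^ 2))) := by
  set U : Matrix (Fin (m + 2)) (Fin 2) ℝ := (of ![a • axis (m + 2), b • γ.1.ofLp])ᵀ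
  set W : Matrix (Fin 2) (Fin (m + 2)) ℝ := of ![axis (m + 2), γ.1.ofLp]
  have h1 : rankTwo a b γ = U * W := by
    ext i j
    simp [rankTwo, U, W, Matrix.mul_apply, vecMulVec_apply, Fin.sum_univ_two]
    ring
  have h2 : W * U = !![a, b * height γ; a * height γ, b] := by
    have e1 := axis_dotProduct_axis (n := m + 2) (by omega)
    have e2 := sphere_dotProduct_self γ
    have e3 : axis (m + 2) ⬝ᵥ γ.1.ofLp = height γ := dotProduct_comm _ _
    have e4 : γ.1.ofLp ⬝ᵥ axis (m + 2) = height γ := rfl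
    ext i j
    have h : (W * U) i j = (![axis (m + 2), γ.1.ofLp] i) ⬝ᵥ
      (![a • axis (m + 2), b • γ.1.ofLp] j) := rfl
    rw [h]
    fin_cases i <;> fin_cases j <;> simp [e1, e2, e3, e4]
  rw [h1, charpoly_mul_comm_of_le U W (by simp), h2, charpoly_fin_two, trace_fin_two_of,
    det_fin_two_of]
  simp only [Fintype.card_fin, Nat.add_sub_cancel]
  congr 4
  ring

theorem exists_eigenvectorBasis {m : ℕ} (a b : ℝ) (γ : UnitSphere (m + 2)) :
    ∃ (q₁ q₂ : ℝ) (v : OrthonormalBasis (Fin (m + 2)) ℝ (EuclideanSpace ℝ (Fin (m + 2)))),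
      q₁ + q₂ = a + b ∧ q₁ * q₂ = a * b * (1 - height γ ^ 2) ∧
      ∀ i, contactTensor a b γ *ᵥ (v i).ofLp =
        (1 + (Fin.cons q₁ (Fin.cons q₂ fun _ => 0) : Fin (m + 2) → ℝ) i) • (v i).ofLp := by
  have hx := height_sq_le_one γ
  set D := (a + b) ^ 2 - 4 * (a * b * (1 - height γ ^ 2)) with hD
  have hD0 : 0 ≤ D := by
    -- The discriminant is a convex combination of (a - b)² and (a + b)², so q₁ and q₂ are real.
    have : D = (a - b) ^ 2 * (1 - height γ ^ 2) + (a + b) ^ 2 * height γ ^ 2 := by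
      rw [hD]; ring
    rw [this]
    have := sub_nonneg.2 hx
    positivity
  have hs := Real.sq_sqrt hD0
  set q₁ := (a + b + √D) / 2 with hq₁
  set q₂ := (a + b - √D) / 2 with hq₂
  have hsum : q₁ + q₂ = a + b := by rw [hq₁, hq₂]; ring
  have hmul : q₁ * q₂ = a * b * (1 - height γ ^ 2) := by
    rw [hq₁, hq₂]
    nlinarith
  have hpoly : (rankTwo a b γ).charpoly = X ^ m * ((X - C q₁) * (X - C q₂)) := by
    rw [charpoly_rankTwo, ← hsum, ← hmul, C_add, C_mul]
    ring
  have hroots : (rankTwo a b γ).charpoly.roots = Multiset.replicate m 0 + ({q₁} + {q₂}) := by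
    rw [hpoly, roots_mul (by
      refine mul_ne_zero (pow_ne_zero _ X_ne_zero) (mul_ne_zero (X_sub_C_ne_zero _)
        (X_sub_C_ne_zero _))), roots_mul (mul_ne_zero (X_sub_C_ne_zero _) (X_sub_C_ne_zero _)),
      roots_X_pow, roots_X_sub_C, roots_X_sub_C, Multiset.nsmul_singleton]
  have hH := rankTwo_isHermitian a b γ
  have heig := hH.roots_charpoly_eq_eigenvalues
  have hmap : Finset.univ.val.map hH.eigenvalues = Finset.univ.val.map
      (Fin.cons q₁ (Fin.cons q₂ fun _ => 0) : Fin (m + 2) → ℝ) := by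
    have h1 : Finset.univ.val.map hH.eigenvalues = (rankTwo a b γ).charpoly.roots := heig.symm
    rw [h1, hroots, Fin.univ_val_map, List.ofFn_cons, List.ofFn_cons, List.ofFn_const,
      ← Multiset.cons_coe, ← Multiset.cons_coe, Multiset.coe_replicate, add_comm,
      Multiset.singleton_add, Multiset.cons_add, Multiset.singleton_add]
  obtain ⟨σ, hσ⟩ := exists_perm_of_map_eq hmap
  refine ⟨q₁, q₂, hH.eigenvectorBasis.reindex σ.symm, hsum, hmul, fun i => ?_⟩
  rw [← hσ, OrthonormalBasis.reindex_apply, Equiv.symm_symm, contactTensor_eq, add_mulVec,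
    one_mulVec, hH.mulVec_eigenvectorBasis, add_smul, one_smul]
  rfl

/-- With m = n - 2, the pair of special eigenvalues gives 2 + a + b, the pairs of one special and
one ordinary eigenvalue give ((2 + q₁)(2 + q₂))^m = Δ^m, and the m(m - 1)/2 ordinary pairs give 2
each. -/
theorem det_L {a b : ℝ} (hn : 2 ≤ n) (γ : UnitSphere n) :
    LinearMap.det (L a b γ) =
      (2 + a + b) * 2 ^ ((n - 2) * (n - 3) / 2) * Delta a b (height γ) ^ (n - 2) := by
  obtain ⟨m, rfl⟩ := Nat.exists_eq_add_of_le' hn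
  obtain ⟨q₁, q₂, v, hsum, hmul, hv⟩ := exists_eigenvectorBasis a b γ
  have hD : Delta a b (height γ) = (2 + q₁) * (2 + q₂) := by
    rw [Delta]
    linear_combination -2 * hsum - hmul
  have h2 : ∏ i : Fin m, ∏ _j ∈ Finset.Ioi i, (2 : ℝ) = 2 ^ (m * (m - 1) / 2) := by
    simp only [Finset.prod_const, Fin.card_Ioi]
    rw [Finset.prod_pow_eq_pow_sum, ← Finset.sum_range_id, ← Finset.sum_range_reflect,
      Finset.sum_range]
  rw [L_eq_inertia, det_inertia v _ _ hv, hD, Fin.prod_univ_succ, Fin.prod_Ioi_zero,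
    Fin.prod_univ_succ, Fin.prod_univ_succ, Fin.prod_Ioi_succ, Fin.prod_Ioi_zero]
  simp only [Fin.prod_Ioi_succ, Fin.cons_zero, Fin.cons_succ, Finset.prod_const,
    Finset.card_univ, Fintype.card_fin, Nat.add_sub_cancel]
  have e1 : ∀ q : ℝ, 1 + q + (1 + 0) = 2 + q := fun q => by ring
  have e2 : (1 : ℝ) + 0 + (1 + 0) = 2 := by norm_num
  -- Truncated subtraction is harmless: for m = 0 both sides are 0.
  have e3 : (m + 2 - 3) = m - 1 := by omega
  have h2' : ∏ x : Fin m, (2 : ℝ) ^ (Finset.Ioi x).card = 2 ^ (m * (m - 1) / 2) := by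
    rw [← h2]
    exact Finset.prod_congr rfl fun i _ => (Finset.prod_const _).symm
  rw [e2, e3, e1, e1, h2', mul_pow, show 1 + q₁ + (1 + q₂) = 2 + a + b by linarith]
  ring

end Determinant

end

end Chaplygin
namespace Chaplygin

noncomputable section

/-! ### The change of variables between velocities and momenta -/

section Velocity

open Set Filter Topology
open scoped RealInnerProductSpace ENNReal

/-- Differentiability of a curve can be tested in coordinates. -/
theorem hasDerivAt_iff_of_injective {F κ : Type*} [NormedAddCommGroup F] [NormedSpace ℝ F]
    [FiniteDimensional ℝ F] [Fintype κ] {J : F →ₗ[ℝ] κ → ℝ} (hJ : Function.Injective J)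
    {c : ℝ → F} {c' : F} {t : ℝ} :
    HasDerivAt c c' t ↔ ∀ k, HasDerivAt (fun s => J (c s) k) (J c' k) t := by
  constructor
  · intro h
    exact hasDerivAt_pi.1 (J.toContinuousLinearMap.hasFDerivAt.comp_hasDerivAt t h)
  · intro h
    obtain ⟨P, hP⟩ := J.exists_leftInverse_of_injective (LinearMap.ker_eq_bot.2 hJ)
    have hP' : ∀ x, P (J x) = x := fun x => DFunLike.congr_fun hP x
    have h1 := P.toContinuousLinearMap.hasFDerivAt.comp_hasDerivAt t (hasDerivAt_pi.2 h)
    have h2 : (P.toContinuousLinearMap ∘ fun s => J (c s)) = c := funext fun s => hP' (c s)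
    have h3 : P.toContinuousLinearMap (J c') = c' := hP' c'
    have h4 : HasDerivAt (P.toContinuousLinearMap ∘ fun s => J (c s))
      (P.toContinuousLinearMap (J c')) t := h1
    rwa [h2, h3] at h4

namespace ContactSystem

variable {S V : Type*} [NormedAddCommGroup S] [InnerProductSpace ℝ S]
    [NormedAddCommGroup V] [InnerProductSpace ℝ V] (d : ContactSystem S V)

omit [NormedAddCommGroup S] [InnerProductSpace ℝ S] [InnerProductSpace ℝ V] in
theorem incl_injective : Function.Injective (incl (S := S) (V := V)) := fun _ _ h =>
  Prod.ext (Prod.ext_iff.1 h).1 (Subtype.ext (Prod.ext_iff.1 h).2)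

variable [FiniteDimensional ℝ S]

theorem exists_isGlobalFlow_field [FiniteDimensional ℝ V] : ∃ φ, IsGlobalFlow d.field φ := by
  have := FiniteDimensional.complete ℝ S
  have := FiniteDimensional.complete ℝ V
  exact d.isProperFirstIntegral_field.exists_isGlobalFlow

theorem isFlow_sphereFlow [FiniteDimensional ℝ V] {φ : ℝ → S × V → S × V}
    (hφ : IsGlobalFlow d.field φ) : IsFlow (fun c : ℝ → S × sphere (0 : V) 1 =>
      ∀ t, HasDerivAt (fun s => incl (c s)) (d.field (incl (c t))) t) (d.sphereFlow hφ) := by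
  have := FiniteDimensional.complete ℝ S
  have := FiniteDimensional.complete ℝ V
  refine fun p c => ⟨fun h t => incl_injective ?_, fun h => ?_⟩
  · rw [incl_sphereFlow, ← h.2]
    exact d.isProperFirstIntegral_field.eq_flow hφ h.1 t
  · obtain rfl : c = fun t => d.sphereFlow hφ t p := funext h
    exact ⟨hφ.hasDerivAt (incl p), incl_injective (hφ.zero (incl p))⟩

variable [MeasurableSpace S] [BorelSpace S] [MeasurableSpace V] [BorelSpace V]
  [FiniteDimensional ℝ V]

/-- The change of variables from velocities to momenta. -/
def momentumEquiv : S × sphere (0 : V) 1 ≃ᵐ S × sphere (0 : V) 1 where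
  toFun p := (d.op p.2 p.1, p.2)
  invFun p := (d.inv p.2 p.1, p.2)
  left_inv _ := Prod.ext (d.inv_op _ _) rfl
  right_inv _ := Prod.ext (d.op_inv _ _) rfl
  measurable_toFun := (((d.contDiff_op.continuous.comp (continuous_subtype_val.comp
    continuous_snd)).clm_apply continuous_fst).prodMk continuous_snd).measurable
  measurable_invFun := (((d.contDiff_inv.continuous.comp (continuous_subtype_val.comp
    continuous_snd)).clm_apply continuous_fst).prodMk continuous_snd).measurable

theorem momentumEquiv_apply (p : S × sphere (0 : V) 1) :
    d.momentumEquiv p = (d.op p.2 p.1, p.2) := rfl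

/-- With γ as the outer variable in Tonelli's theorem, the inner integral is a linear substitution
whose factor 1/det L_γ cancels the determinant in the weight. -/
theorem map_momentumEquiv (ν : Measure S) [ν.IsAddHaarMeasure]
    (σ : Measure (sphere (0 : V) 1)) [SFinite σ] {g : sphere (0 : V) 1 → ℝ≥0∞}
    (hg : Measurable g) :
    ((ν.prod σ).withDensity fun p => ENNReal.ofReal (d.op p.2).det * g p.2).map d.momentumEquiv =
      (ν.prod σ).withDensity fun p => g p.2 := by
  have hdet : Measurable fun γ : sphere (0 : V) 1 => ENNReal.ofReal (d.op γ).det :=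
    (((contDiff_det (m := 1)).comp d.contDiff_op).continuous.comp
      continuous_subtype_val).measurable.ennreal_ofReal
  have hw : Measurable fun p : S × sphere (0 : V) 1 => ENNReal.ofReal (d.op p.2).det * g p.2 :=
    (hdet.mul hg).comp measurable_snd
  have hg' : Measurable fun p : S × sphere (0 : V) 1 => g p.2 := hg.comp measurable_snd
  refine Measure.ext_of_lintegral _ fun f hf => ?_
  have hfe : Measurable fun p => f (d.momentumEquiv p) := hf.comp d.momentumEquiv.measurable
  rw [lintegral_map hf d.momentumEquiv.measurable, lintegral_withDensity_eq_lintegral_mul _ hw hfe,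
    lintegral_withDensity_eq_lintegral_mul _ hg' hf, lintegral_prod_symm' _ (hw.mul hfe),
    lintegral_prod_symm' _ (hg'.mul hf)]
  refine lintegral_congr fun γ => ?_
  have hfγ : Measurable fun M : S => f (M, γ) := hf.comp measurable_prodMk_right
  have hpos := d.det_op_pos (γ : V)
  have hne : LinearMap.det (d.op γ : S →ₗ[ℝ] S) ≠ 0 := hpos.ne'
  have h1 : ∫⁻ Ω, f (d.op γ Ω, γ) ∂ν = ENNReal.ofReal (d.op γ).det⁻¹ * ∫⁻ M, f (M, γ) ∂ν := by
    have h2 := Measure.map_linearMap_addHaar_eq_smul_addHaar ν hne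
    have h3 : ∫⁻ M, f (M, γ) ∂(ν.map (d.op γ : S →ₗ[ℝ] S)) = ∫⁻ Ω, f (d.op γ Ω, γ) ∂ν :=
      lintegral_map hfγ (d.op (γ : V)).continuous.measurable
    rw [← h3, h2, lintegral_smul_measure, smul_eq_mul]
    congr 2
    exact abs_of_pos (inv_pos.2 hpos)
  simp only [Pi.mul_apply, momentumEquiv_apply]
  have hfo : Measurable fun Ω : S => f (d.op γ Ω, γ) :=
    hfγ.comp (d.op (γ : V)).continuous.measurable
  rw [lintegral_const_mul _ hfo, lintegral_const_mul _ hfγ, h1, mul_mul_mul_comm,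
    ← ENNReal.ofReal_mul hpos.le, mul_inv_cancel₀ hpos.ne', ENNReal.ofReal_one, one_mul]

end ContactSystem

end Velocity

/-! ### The Chaplygin sphere: flows and invariant measures -/

section Chaplygin

open Set Filter Topology
open scoped ENNReal

attribute [local instance] isTopologicalAddGroup_so continuousConstSMul_so soNormedAddCommGroup
  soInnerProductSpace

variable {n : ℕ}

theorem hasDerivAt_so_iff {c : ℝ → so (Fin n) ℝ} {c' : so (Fin n) ℝ} {t : ℝ} :
    HasDerivAt c c' t ↔ ∀ i j, HasDerivAt (fun s => (c s).1 i j) (c'.1 i j) t := by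
  let J : so (Fin n) ℝ →ₗ[ℝ] Fin n × Fin n → ℝ :=
    { toFun := fun A k => A.1 k.1 k.2
      map_add' := fun _ _ => rfl
      map_smul' := fun _ _ => rfl }
  have hJ : Function.Injective J := fun A B h =>
    Subtype.ext (Matrix.ext fun i j => congrFun h (i, j))
  rw [hasDerivAt_iff_of_injective hJ, Prod.forall]
  rfl

theorem hasDerivAt_euclidean_iff {c : ℝ → EuclideanSpace ℝ (Fin n)}
    {c' : EuclideanSpace ℝ (Fin n)} {t : ℝ} :
    HasDerivAt c c' t ↔ ∀ i, HasDerivAt (fun s => c s i) (c' i) t :=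
  hasDerivAt_iff_of_injective (J := (WithLp.linearEquiv 2 ℝ (Fin n → ℝ)).toLinearMap)
    (WithLp.linearEquiv 2 ℝ (Fin n → ℝ)).injective

variable {a b : ℝ} (ha : -1 ≤ a) (hb : 0 ≤ b)

theorem isMotion_iff {M Ω : ℝ → so (Fin n) ℝ} {γ : ℝ → UnitSphere n} :
    IsMotion a b M Ω γ ↔ (∀ t, M t = L a b (γ t) (Ω t)) ∧
      ∀ t, HasDerivAt (fun s => ContactSystem.incl (M s, γ s))
        ((soAction n).br (M t) (Ω t), -(soAction n).act (Ω t) (γ t)) t := by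
  have h : ∀ t, HasDerivAt (fun s => ContactSystem.incl (M s, γ s))
      ((soAction n).br (M t) (Ω t), -(soAction n).act (Ω t) (γ t)) t ↔
      HasDerivAt M ((soAction n).br (M t) (Ω t)) t ∧
        HasDerivAt (fun s => ((γ s : UnitSphere n) : EuclideanSpace ℝ (Fin n)))
          (-(soAction n).act (Ω t) (γ t)) t := fun t =>
    ⟨fun h => ⟨hasDerivAt_fst h, hasDerivAt_snd h⟩, fun h => h.1.prodMk h.2⟩
  simp only [h, hasDerivAt_so_iff, hasDerivAt_euclidean_iff]
  exact ⟨fun h => ⟨h.1, fun t => ⟨h.2 t, h.3 t⟩⟩, fun h => ⟨h.1, fun t => (h.2 t).1,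
    fun t => (h.2 t).2⟩⟩

theorem L_apply_eq (γ : UnitSphere n) (Ω : so (Fin n) ℝ) :
    L a b γ Ω = (chaplyginSystem n ha hb).op γ Ω := by
  rw [← op_chaplyginSystem ha hb, ContinuousLinearMap.coe_coe]

theorem isMomentumSolution_iff (c : ℝ → Phase n) :
    IsMomentumSolution a b c ↔ ∀ t, HasDerivAt (fun s => ContactSystem.incl (c s))
      ((chaplyginSystem n ha hb).field (ContactSystem.incl (c t))) t := by
  simp only [IsMomentumSolution, isMotion_iff, L_apply_eq ha hb]
  constructor
  · rintro ⟨Ω, h1, h2⟩ t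
    have h3 : Ω t = (chaplyginSystem n ha hb).inv (c t).2 (c t).1 := by
      rw [h1, ContactSystem.inv_op]
    have h4 := h2 t
    rwa [h3] at h4
  · intro h
    exact ⟨fun t => (chaplyginSystem n ha hb).inv (c t).2 (c t).1,
      fun t => (ContactSystem.op_inv _ _ _).symm, h⟩

theorem coe_momentumEquiv : ⇑(chaplyginSystem n ha hb).momentumEquiv = legendre a b :=
  funext fun p => Prod.ext (L_apply_eq ha hb p.2 p.1).symm rfl

theorem isVelocitySolution_iff (c : ℝ → Phase n) :
    IsVelocitySolution a b c ↔
      IsMomentumSolution a b fun t => (chaplyginSystem n ha hb).momentumEquiv (c t) := by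
  rw [coe_momentumEquiv]
  constructor
  · rintro ⟨M, h⟩
    refine ⟨fun t => (c t).1, ?_⟩
    obtain rfl : M = fun t => L a b (c t).2 (c t).1 := funext h.momentum
    exact h
  · rintro ⟨Ω, h⟩
    refine ⟨fun t => L a b (c t).2 (c t).1, ?_⟩
    obtain rfl : Ω = fun t => (c t).1 := funext fun t => by
      have h1 := h.momentum t
      simp only [legendre, L_apply_eq ha hb] at h1
      exact ((chaplyginSystem n ha hb).op_injective _ h1).symm
    exact h

theorem measurable_Delta_rpow (s : ℝ) :
    Measurable fun γ : UnitSphere n => ENNReal.ofReal (Delta a b (height γ) ^ s) := by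
  have h : Continuous fun γ : UnitSphere n => Delta a b (height γ) := by
    unfold Delta height dotProduct
    fun_prop
  exact (h.measurable.pow_const s).ennreal_ofReal

theorem det_op_chaplyginSystem (hn : 2 ≤ n) (γ : UnitSphere n) :
    ((chaplyginSystem n ha hb).op γ).det =
      (2 + a + b) * 2 ^ ((n - 2) * (n - 3) / 2) * Delta a b (height γ) ^ (n - 2) := by
  rw [← det_L hn, ← op_chaplyginSystem ha hb]

theorem Delta_rpow_mul {x : ℝ} (hn : 2 ≤ n) (hx : 0 < Delta a b x) (r : ℝ) :
    Delta a b x ^ (((n : ℝ) - 2) * r) = (Delta a b x ^ (n - 2)) ^ r := by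
  rw [← Real.rpow_natCast, ← Real.rpow_mul hx.le, Nat.cast_sub hn, Nat.cast_ofNat]

/-- The flow in the variables `(M, γ)`. -/
theorem exists_isFlow_momentum (ha : -1 ≤ a) (hb : 0 ≤ b) (hn : 2 ≤ n) (ν : Measure (so (Fin n) ℝ)) [ν.IsAddHaarMeasure] :
    ∃ Φ : ℝ → Phase n → Phase n, IsFlow (IsMomentumSolution a b) Φ ∧
      ∀ t, MeasurePreserving (Φ t) (deltaMeasure a b (-(((n : ℝ) - 2) / 2)) ν)
        (deltaMeasure a b (-(((n : ℝ) - 2) / 2)) ν) := by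
  -- This makes ℝⁿ nontrivial, so that its unit sphere is nonempty.
  have : NeZero n := ⟨by omega⟩
  set d := chaplyginSystem n ha hb
  obtain ⟨φ, hφ⟩ := d.exists_isGlobalFlow_field
  refine ⟨d.sphereFlow hφ, ?_, fun t => ?_⟩
  · rw [funext fun c => propext (isMomentumSolution_iff ha hb c)]
    exact d.isFlow_sphereFlow hφ
  · have h := d.measurePreserving_sphereFlow hφ (isHomogeneous_chaplyginSystem ha hb) ν volume t
    have hc : 0 < (2 + a + b) * 2 ^ ((n - 2) * (n - 3) / 2) := by
      have : 0 < 2 + a + b := by linarith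
      positivity
    -- As det L = cΔ^(n-2), the density (det L)^(-1/2) is c^(-1/2) Δ^(-(n-2)/2). The constant factor
    -- does not affect invariance.
    set C := ((2 + a + b) * 2 ^ ((n - 2) * (n - 3) / 2)) ^ (-(1 / 2) : ℝ)
    have hC : 0 < C := Real.rpow_pos_of_pos hc _
    have hdens : ∀ p : Phase n, ENNReal.ofReal (d.density (ContactSystem.incl p)) =
        ENNReal.ofReal C * ENNReal.ofReal (Delta a b (height p.2) ^ (-(((n : ℝ) - 2) / 2))) := by
      intro p
      have hD := Delta_pos ha hb (height_sq_le_one p.2)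
      rw [← ENNReal.ofReal_mul hC.le, show -(((n : ℝ) - 2) / 2) = ((n : ℝ) - 2) * (-(1 / 2)) by ring,
        Delta_rpow_mul hn hD, ← Real.mul_rpow hc.le (pow_nonneg hD.le _),
        ← det_op_chaplyginSystem ha hb hn]
      rfl
    have hm : (ν.prod volume.toSphere).withDensity
        (fun p : Phase n => ENNReal.ofReal (d.density (ContactSystem.incl p))) =
          ENNReal.ofReal C • deltaMeasure a b (-(((n : ℝ) - 2) / 2)) ν := by
      simp only [hdens]
      exact withDensity_smul _ ((measurable_Delta_rpow _).comp measurable_snd)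
    rw [hm] at h
    exact measurePreserving_of_smul (ENNReal.ofReal_pos.2 hC).ne' ENNReal.ofReal_ne_top h

/-- The Jacobian factor gives det L · Δ^(-(n-2)/2) = cΔ^((n-2)/2). -/
theorem measurePreserving_momentumEquiv (hn : 2 ≤ n) (ν : Measure (so (Fin n) ℝ))
    [ν.IsAddHaarMeasure] :
    MeasurePreserving (chaplyginSystem n ha hb).momentumEquiv
      (ENNReal.ofReal ((2 + a + b) * 2 ^ ((n - 2) * (n - 3) / 2)) •
        deltaMeasure a b (((n : ℝ) - 2) / 2) ν) (deltaMeasure a b (-(((n : ℝ) - 2) / 2)) ν) := by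
  set d := chaplyginSystem n ha hb
  refine ⟨d.momentumEquiv.measurable, ?_⟩
  have h := d.map_momentumEquiv ν (volume : Measure (EuclideanSpace ℝ (Fin n))).toSphere
    (measurable_Delta_rpow (a := a) (b := b) (-(((n : ℝ) - 2) / 2)))
  have hc : 0 < (2 + a + b) * 2 ^ ((n - 2) * (n - 3) / 2) := by
    have : 0 < 2 + a + b := by linarith
    positivity
  have hdens : ∀ p : Phase n, ENNReal.ofReal (d.op p.2).det *
      ENNReal.ofReal (Delta a b (height p.2) ^ (-(((n : ℝ) - 2) / 2))) =
        ENNReal.ofReal ((2 + a + b) * 2 ^ ((n - 2) * (n - 3) / 2)) *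
          ENNReal.ofReal (Delta a b (height p.2) ^ (((n : ℝ) - 2) / 2)) := by
    intro p
    have hD := Delta_pos ha hb (height_sq_le_one p.2)
    have h1 := Delta_rpow_mul hn hD 1
    rw [mul_one, Real.rpow_one] at h1
    rw [← ENNReal.ofReal_mul (d.det_op_pos _).le, ← ENNReal.ofReal_mul hc.le,
      det_op_chaplyginSystem ha hb hn, ← h1, mul_assoc, ← Real.rpow_add hD]
    congr 3
    ring
  simp only [hdens] at h
  refine Eq.trans (congrArg _ ?_) h
  exact (withDensity_smul _ ((measurable_Delta_rpow _).comp measurable_snd)).symm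

/-- The flow in the variables `(Ω, γ)`. -/
theorem exists_isFlow_velocity (ha : -1 ≤ a) (hb : 0 ≤ b) (hn : 2 ≤ n) (ν : Measure (so (Fin n) ℝ)) [ν.IsAddHaarMeasure] :
    ∃ Ψ : ℝ → Phase n → Phase n, IsFlow (IsVelocitySolution a b) Ψ ∧
      ∀ t, MeasurePreserving (Ψ t) (deltaMeasure a b (((n : ℝ) - 2) / 2) ν)
        (deltaMeasure a b (((n : ℝ) - 2) / 2) ν) := by
  obtain ⟨Φ, hΦ, hm⟩ := exists_isFlow_momentum ha hb hn ν
  set e := (chaplyginSystem n ha hb).momentumEquiv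
  -- The velocity flow is the momentum flow conjugated by L. It preserves the pulled-back measure,
  -- from which the constant c is then cancelled.
  refine ⟨fun t p => e.symm (Φ t (e p)), fun p c => ?_, fun t => ?_⟩
  · have h := hΦ (e p) fun t => e (c t)
    rw [← isVelocitySolution_iff ha hb, e.injective.eq_iff] at h
    rw [h]
    exact forall_congr' fun t => ⟨fun h => by simp only [← h, e.symm_apply_apply],
      fun h => by simp only [h, e.apply_symm_apply]⟩
  · have he := measurePreserving_momentumEquiv ha hb hn ν
    have hc : 0 < (2 + a + b) * 2 ^ ((n - 2) * (n - 3) / 2) := by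
      have : 0 < 2 + a + b := by linarith
      positivity
    exact measurePreserving_of_smul (ENNReal.ofReal_pos.2 hc).ne' ENNReal.ofReal_ne_top
      ((he.symm e).comp ((hm t).comp he))

end Chaplygin

end

end Chaplygin
theorem mainTheorem3 (n : ℕ) (hn : 2 ≤ n) (a b : ℝ) (ha : a ∈ Set.Icc (-1 : ℝ) 1) (hb : 0 < b)
    (ν : Measure (so (Fin n) ℝ)) [ν.IsAddHaarMeasure] :
    (∀ γ : Chaplygin.UnitSphere n, 0 < Chaplygin.Delta a b (Chaplygin.height γ) ∧
      LinearMap.det (Chaplygin.L a b γ) =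
        (2 + a + b) * 2 ^ ((n - 2) * (n - 3) / 2) *
          Chaplygin.Delta a b (Chaplygin.height γ) ^ (n - 2)) ∧
    (∃ Φ : ℝ → Chaplygin.Phase n → Chaplygin.Phase n,
      Chaplygin.IsFlow (Chaplygin.IsMomentumSolution a b) Φ ∧
      ∀ t, MeasurePreserving (Φ t) (Chaplygin.deltaMeasure a b (-(((n : ℝ) - 2) / 2)) ν)
        (Chaplygin.deltaMeasure a b (-(((n : ℝ) - 2) / 2)) ν)) ∧
    (∃ Ψ : ℝ → Chaplygin.Phase n → Chaplygin.Phase n,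
      Chaplygin.IsFlow (Chaplygin.IsVelocitySolution a b) Ψ ∧
      ∀ t, MeasurePreserving (Ψ t) (Chaplygin.deltaMeasure a b (((n : ℝ) - 2) / 2) ν)
        (Chaplygin.deltaMeasure a b (((n : ℝ) - 2) / 2) ν)) ∧
    Function.Bijective (Chaplygin.legendre (n := n) a b) ∧
    MeasurePreserving (Chaplygin.legendre (n := n) a b)
      (ENNReal.ofReal ((2 + a + b) * 2 ^ ((n - 2) * (n - 3) / 2)) •
        Chaplygin.deltaMeasure a b (((n : ℝ) - 2) / 2) ν)
      (Chaplygin.deltaMeasure a b (-(((n : ℝ) - 2) / 2)) ν) := by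
  have hb' := hb.le
  refine ⟨fun γ => ⟨Chaplygin.Delta_pos ha.1 hb' (Chaplygin.height_sq_le_one γ),
      Chaplygin.det_L hn γ⟩, Chaplygin.exists_isFlow_momentum ha.1 hb' hn ν,
    Chaplygin.exists_isFlow_velocity ha.1 hb' hn ν, ?_, ?_⟩
  · rw [← Chaplygin.coe_momentumEquiv ha.1 hb']
    exact MeasurableEquiv.bijective _
  · rw [← Chaplygin.coe_momentumEquiv ha.1 hb']
    exact Chaplygin.measurePreserving_momentumEquiv ha.1 hb' hn ν
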